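/- Let $H$ be an $r$-uniform hypergraph on finitely many vertices and let $d,D,m$ be non-negative integers. We say that $H$ is semi-algebraic of complexity $\mathbf{t}=(d,D,m)$ if there are an enumeration $v_1,\dots,v_N$ of its vertices, points $p_1,\dots,p_N\in\mathbb{R}^d$, real polynomials $f_1,\dots,f_m:(\mathbb{R}^d)^r\to\mathbb{R}$ of total degree at most $D$, and a function $\Phi:\{+,-,0\}^m\to\{\text{True},\text{False}\}$ such that for all $1\le i_1<\dots<i_r\le N$, the set $\{v_{i_1},\dots,v_{i_r}\}$ is an edge of $H$ if and only if $$\Phi\bigl(\operatorname{sign} f_1(p_{i_1},\dots,p_{i_r}),\dots,\operatorname{sign} f_m(p_{i_1},\dots,p_{i_r})\bigr)=\text{True}.$$ Let $R_r^{\mathbf{t}}(s,n)$ denote the smallest $N$ such that every $r$-uniform semi-algebraic hypergraph of complexity $\mathbf{t}$ on $N$ vertices contains a clique of size $s$ (a set of $s$ vertices all of whose $r$-element subsets are edges) or an independent set of size $n$ (a set of $n$ vertices containing no edge). Let $\operatorname{tw}_1(x)=x$ and $\operatorname{tw}_{k+1}(x)=2^{\operatorname{tw}_k(x)}$ for $k\ge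 1$. **Corollary.** For every $r\ge 3$ there exist $s$ and $\mathbf{t}=(d,D,m)$ such that $$R_r^{\mathbf{t}}(s,n)>\operatorname{tw}_{r-1}\bigl((\log n)^{4/3-o(1)}\bigr)\qquad(n\to\infty),$$ that is, there is a real sequence $\varepsilon_n\to 0$ (which may depend on $r$, $s$, $\mathbf{t}$) such that $R_r^{\mathbf{t}}(s,n)>\operatorname{tw}_{r-1}\bigl((\log n)^{4/3-\varepsilon_n}\bigr)$ for all sufficiently large $n$. -/

import Mathlib

open Filter Topology

/-- An `r`-uniform hypergraph with vertex set `V`: a family of `r`-element subsets of `V`. -/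
structure UniformHypergraph (r : ℕ) (V : Type*) where
  /-- The edges. -/
  edges : Set (Finset V)
  /-- Every edge has exactly `r` elements. -/
  card_eq : ∀ e ∈ edges, e.card = r

namespace UniformHypergraph

variable {r : ℕ} {V : Type*}

/-- A set of vertices is a clique if all of its `r`-element subsets are edges. -/
def IsClique (H : UniformHypergraph r V) (S : Finset V) : Prop :=
  ∀ e ⊆ S, e.card = r → e ∈ H.edges

/-- A set of vertices is independent if it contains no edge. -/
def IsIndep (H : UniformHypergraph r V) (S : Finset V) : Prop :=
  ∀ e ⊆ S, e ∉ H.edges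

/-- `H` is semi-algebraic of complexity `(d, D, m)`: there are an enumeration `v` of the vertices,
points `p i ∈ ℝ ^ d`, and `m` polynomials `f j` of degree at most `D` on `(ℝ ^ d) ^ r` (the variable
`(k, l)` is the `l`-th coordinate of the `k`-th point) such that, for `i₁ < ⋯ < iᵣ`, whether
`{v i₁, …, v iᵣ}` is an edge is a function `Φ` of the signs of the `f j (p i₁, …, p iᵣ)`. -/
def IsSemialgebraic (H : UniformHypergraph r V) (d D m : ℕ) : Prop :=
  ∃ (N : ℕ) (v : Fin N ≃ V) (p : Fin N → Fin d → ℝ)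
    (f : Fin m → MvPolynomial (Fin r × Fin d) ℝ) (Φ : (Fin m → SignType) → Prop),
    (∀ j, (f j).totalDegree ≤ D) ∧
    ∀ i : Fin r ↪o Fin N,
      Finset.univ.map (i.toEmbedding.trans v.toEmbedding) ∈ H.edges ↔
        Φ fun j => SignType.sign (MvPolynomial.eval (fun kl => p (i kl.1) kl.2) (f j))

end UniformHypergraph

/-- The semi-algebraic Ramsey number `R_r^{(d, D, m)}(s, n)`: the smallest `N` such that every
`r`-uniform semi-algebraic hypergraph of complexity `(d, D, m)` on `N` vertices contains a clique
of size `s` or an independent set of size `n`. -/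
noncomputable def semialgRamsey (r d D m s n : ℕ) : ℕ :=
  sInf {N : ℕ | ∀ H : UniformHypergraph r (Fin N), H.IsSemialgebraic d D m →
    (∃ S : Finset (Fin N), S.card = s ∧ H.IsClique S) ∨
    (∃ S : Finset (Fin N), S.card = n ∧ H.IsIndep S)}

/-- The tower function: `tower 1 x = x` and `tower (k + 1) x = 2 ^ tower k x` for `k ≥ 1`
(the value at height `0` is irrelevant). -/
noncomputable def tower : ℕ → ℝ → ℝ
  | 0, x => x
  | 1, x => x
  | k + 2, x => 2 ^ tower (k + 1) x

set_option linter.unusedSectionVars false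

/-! `Hits (fun u => ¬ E u) s` excludes cliques of size `s`, and `Hits E n` excludes independent sets
of size `n`. The proof builds `E` with both properties on very many vertices. The base is a
triangle-free graph on the `M ^ 4` incidences of `M ^ 3` lines with grid points, where an
independent set has at most `3 * M ^ 3` vertices (`hits_incidenceRel`). This is the source of the
exponent 4/3. Stepping up replaces `V` by the binary words on `V` and judges a tuple of words by its
gaps. From graphs to triples, the number of vertices and the independence bound are both
exponentiated (`hits_three`): there are `2 ^ M ^ 4` vertices against `n = 2 ^ O(M ^ 3)`, hence `(log
n) ^ (4/3)`. Each further step exponentiates only the number of vertices, while both bounds roughly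
double (`hits_not_stepUp`, `hits_stepUp`), so the tower grows by one storey. Bounded complexity
survives (`Realizes.stepUp`). A word is sent to the sum of its coordinates' points weighted by
powers of a huge `T`, so the difference of two words, rescaled, is close to the point of their
`topDiff`. This is why predicates are kept invariant under positive rescaling and are required to
hold on neighbourhoods. The polynomials depend on `r` only, not on `M`. -/

/-- Every set of at least `s` vertices contains an increasing `r`-tuple satisfying `E`. -/
def Hits {r : ℕ} {V : Type*} [LinearOrder V] (E : (Fin r → V) → Prop) (s : ℕ) : Prop :=
  ∀ S : Finset V, s ≤ S.card → ∃ u : Fin r → V, StrictMono u ∧ (∀ k, u k ∈ S) ∧ E u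

theorem Hits.mono {r : ℕ} {V : Type*} [LinearOrder V] {E : (Fin r → V) → Prop} {s t : ℕ}
    (h : Hits E s) (hst : s ≤ t) : Hits E t :=
  fun S hS => h S (hst.trans hS)

/-! ### Binary words and the combinatorics of stepping up. -/

section Tree

variable {V : Type*} [LinearOrder V] [Finite V] [Nonempty V]

/-- The largest coordinate at which two binary words differ (meaningful for `a < b`). -/
noncomputable def topDiff (a b : Colex (V → Bool)) : V :=
  Classical.epsilon fun i => (∀ j, i < j → a j = b j) ∧ a i = false ∧ b i = true

theorem topDiff_spec {a b : Colex (V → Bool)} (h : a < b) :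
    (∀ j, topDiff a b < j → a j = b j) ∧ a (topDiff a b) = false ∧ b (topDiff a b) = true := by
  obtain ⟨i, hi, hlt⟩ := h
  refine Classical.epsilon_spec
    (p := fun i => (∀ j, i < j → a j = b j) ∧ a i = false ∧ b i = true) ⟨i, fun j hj => hi j hj, ?_⟩
  exact Bool.lt_iff.1 hlt

theorem colex_lt_of {a b : Colex (V → Bool)} {i : V} (h : ∀ j, i < j → a j = b j)
    (ha : a i = false) (hb : b i = true) : a < b :=
  ⟨i, fun j hj => h j hj, Bool.lt_iff.2 ⟨ha, hb⟩⟩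

theorem topDiff_eq {a b : Colex (V → Bool)} {i : V} (h : ∀ j, i < j → a j = b j)
    (ha : a i = false) (hb : b i = true) : topDiff a b = i := by
  obtain ⟨h1, h2, h3⟩ := topDiff_spec (colex_lt_of h ha hb)
  rcases lt_trichotomy (topDiff a b) i with hlt | heq | hgt
  · have := h1 i hlt
    rw [ha, hb] at this
    exact absurd this (by decide)
  · exact heq
  · have := h _ hgt
    rw [h2, h3] at this
    exact absurd this (by decide)

theorem topDiff_ne {a b c : Colex (V → Bool)} (hab : a < b) (hbc : b < c) :
    topDiff a b ≠ topDiff b c := by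
  intro h
  have h1 := (topDiff_spec hab).2.2
  have h2 := (topDiff_spec hbc).2.1
  rw [h, h2] at h1
  exact absurd h1 (by decide)

theorem topDiff_of_lt {a b c : Colex (V → Bool)} (hab : a < b) (hbc : b < c)
    (h : topDiff a b < topDiff b c) : topDiff a c = topDiff b c := by
  obtain ⟨h1, _, _⟩ := topDiff_spec hab
  obtain ⟨k1, k2, k3⟩ := topDiff_spec hbc
  refine topDiff_eq (fun j hj => (h1 j (h.trans hj)).trans (k1 j hj)) ?_ k3
  rw [h1 _ h, k2]

theorem topDiff_of_gt {a b c : Colex (V → Bool)} (hab : a < b) (hbc : b < c)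
    (h : topDiff b c < topDiff a b) : topDiff a c = topDiff a b := by
  obtain ⟨h1, h2, h3⟩ := topDiff_spec hab
  obtain ⟨k1, _, _⟩ := topDiff_spec hbc
  refine topDiff_eq (fun j hj => (h1 j hj).trans (k1 j (h.trans hj))) h2 ?_
  rw [← k1 _ h, h3]

/-- The differing coordinates of consecutive words of a tuple. -/
noncomputable def gaps {r : ℕ} (a : Fin (r + 1) → Colex (V → Bool)) : Fin r → V :=
  fun k => topDiff (a k.castSucc) (a k.succ)

/-- The stepping-up relation on binary words: monotone gap sequences are judged by `E`, all others
by their first comparison. -/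
def stepUp {r : ℕ} (E : (Fin r → V) → Prop) (a : Fin (r + 1) → Colex (V → Bool)) : Prop :=
  (StrictMono (gaps a) ∧ E (gaps a)) ∨ (StrictAnti (gaps a) ∧ E (gaps a ∘ Fin.rev)) ∨
    (¬ StrictMono (gaps a) ∧ ¬ StrictAnti (gaps a) ∧
      ∃ i j : Fin r, i.val = 0 ∧ j.val = 1 ∧ gaps a j < gaps a i)

theorem not_strictMono_of_strictAnti {r : ℕ} (hr : 2 ≤ r) {g : Fin r → V} (h : StrictAnti g) :
    ¬ StrictMono g := by
  intro h'
  have h0 : (⟨0, by omega⟩ : Fin r) < ⟨1, by omega⟩ := by simp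
  exact lt_asymm (h h0) (h' h0)

theorem stepUp_of_strictMono {r : ℕ} (hr : 2 ≤ r) {E : (Fin r → V) → Prop}
    {a : Fin (r + 1) → Colex (V → Bool)} (h : StrictMono (gaps a)) :
    stepUp E a ↔ E (gaps a) := by
  have h' : ¬ StrictAnti (gaps a) := fun h' => not_strictMono_of_strictAnti hr h' h
  simp [stepUp, h, h']

theorem stepUp_of_strictAnti {r : ℕ} (hr : 2 ≤ r) {E : (Fin r → V) → Prop}
    {a : Fin (r + 1) → Colex (V → Bool)} (h : StrictAnti (gaps a)) :
    stepUp E a ↔ E (gaps a ∘ Fin.rev) := by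
  simp [stepUp, h, not_strictMono_of_strictAnti hr h]

/-- Words that branch at only `t` levels number at most `2 ^ t`. At the highest branching level `i`,
one of the two branches keeps more than `2 ^ t` words; any pair inside it that splits at a lower
level becomes a triple on adding a word of the other branch. -/
theorem exists_levels (t : ℕ) : ∀ S : Finset (Colex (V → Bool)), 2 ^ t < S.card →
    ∃ T : Finset V, T.card = t + 1 ∧ (∀ i ∈ T, ∃ a ∈ S, ∃ b ∈ S, a < b ∧ topDiff a b = i) ∧
      ∀ i ∈ T, ∀ j ∈ T, i < j → ∃ a : Fin 3 → Colex (V → Bool), StrictMono a ∧ (∀ k, a k ∈ S) ∧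
        (gaps a = ![i, j] ∨ gaps a = ![j, i]) := by
  classical
  induction t with
  | zero =>
    intro S hS
    obtain ⟨a, ha, b, hb, hab⟩ := Finset.one_lt_card.1 (by simpa using hS)
    wlog hlt : a < b generalizing a b
    · exact this b hb a ha hab.symm (lt_of_le_of_ne (not_lt.1 hlt) hab.symm)
    refine ⟨{topDiff a b}, by simp, ?_, ?_⟩
    · intro i hi
      exact ⟨a, ha, b, hb, hlt, (Finset.mem_singleton.1 hi).symm⟩
    · intro i hi j hj hij
      rw [Finset.mem_singleton] at hi hj
      exact absurd hij (by simp [hi, hj])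
  | succ t ih =>
    intro S hS
    have hex : {i : V | ∃ a ∈ S, ∃ b ∈ S, a i ≠ b i}.Nonempty := by
      obtain ⟨a, ha, b, hb, hab⟩ := Finset.one_lt_card.1
        (lt_of_le_of_lt (Nat.one_le_two_pow (n := t + 1)) hS)
      by_contra hcon
      rw [Set.not_nonempty_iff_eq_empty, Set.eq_empty_iff_forall_notMem] at hcon
      apply hab
      funext i
      by_contra hne
      exact hcon i ⟨a, ha, b, hb, hne⟩
    obtain ⟨i, ⟨a₀, ha₀, b₀, hb₀, hne⟩, himax⟩ :=
      Set.exists_max_image _ id (Set.toFinite _) hex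
    have hagree : ∀ a ∈ S, ∀ b ∈ S, ∀ j, i < j → a j = b j := by
      intro a ha b hb j hj
      by_contra hne
      exact absurd (himax j ⟨a, ha, b, hb, hne⟩) (not_le.2 hj)
    have hlow : ∀ v, ∀ a ∈ S, ∀ b ∈ S, a i = v → b i = v → a < b → topDiff a b < i := by
      intro v a ha b hb hav hbv hab
      obtain ⟨-, h2, h3⟩ := topDiff_spec hab
      have hle : topDiff a b ≤ i := himax (topDiff a b) ⟨a, ha, b, hb, by rw [h2, h3]; decide⟩
      refine lt_of_le_of_ne hle fun h => ?_
      rw [h, hav] at h2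
      rw [h, hbv] at h3
      rw [h2] at h3
      exact absurd h3 (by decide)
    have hsplit : ∀ v : Bool, ∃ c ∈ S, c i = v := by
      intro v
      by_cases h : a₀ i = v
      · exact ⟨a₀, ha₀, h⟩
      · refine ⟨b₀, hb₀, ?_⟩
        revert h hne
        cases a₀ i <;> cases b₀ i <;> cases v <;> simp
    have hbig : ∃ v : Bool, 2 ^ t < (S.filter fun a => a i = v).card := by
      by_contra hcon
      push Not at hcon
      have h1 := hcon true
      have h2 := hcon false
      have h3 := Finset.card_filter_add_card_filter_not (s := S) (fun a => a i = true)
      simp only [Bool.not_eq_true] at h3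
      rw [pow_succ] at hS
      omega
    obtain ⟨v, hv⟩ := hbig
    obtain ⟨T, hT, hlev, hpair⟩ := ih _ hv
    have hTlt : ∀ j ∈ T, j < i := by
      intro j hj
      obtain ⟨a, ha, b, hb, hab, rfl⟩ := hlev j hj
      rw [Finset.mem_filter] at ha hb
      exact hlow v a ha.1 b hb.1 ha.2 hb.2 hab
    have hiT : i ∉ T := fun h => lt_irrefl _ (hTlt i h)
    have htop : ∀ j ∈ T, ∃ a : Fin 3 → Colex (V → Bool), StrictMono a ∧ (∀ k, a k ∈ S) ∧
        (gaps a = ![j, i] ∨ gaps a = ![i, j]) := by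
      intro j hj
      obtain ⟨a, ha, b, hb, hab, hd⟩ := hlev j hj
      rw [Finset.mem_filter] at ha hb
      obtain ⟨c, hc, hcv⟩ := hsplit (!v)
      -- The added word lies above or below the pair according to `v`, which decides the order of
      -- the two gaps.
      cases v with
      | false =>
        have hbc : b < c := colex_lt_of (hagree b hb.1 c hc) hb.2 hcv
        have hbc' : topDiff b c = i := topDiff_eq (hagree b hb.1 c hc) hb.2 hcv
        refine ⟨![a, b, c], ?_, ?_, Or.inl ?_⟩
        · rw [Fin.strictMono_iff_lt_succ]
          intro k
          fin_cases k
          · exact hab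
          · exact hbc
        · intro k
          fin_cases k
          · exact ha.1
          · exact hb.1
          · exact hc
        · funext k
          fin_cases k
          · exact hd
          · exact hbc'
      | true =>
        have hca : c < a := colex_lt_of (hagree c hc a ha.1) hcv ha.2
        have hca' : topDiff c a = i := topDiff_eq (hagree c hc a ha.1) hcv ha.2
        refine ⟨![c, a, b], ?_, ?_, Or.inr ?_⟩
        · rw [Fin.strictMono_iff_lt_succ]
          intro k
          fin_cases k
          · exact hca
          · exact hab
        · intro k
          fin_cases k
          · exact hc
          · exact ha.1
          · exact hb.1
        · funext k
          fin_cases k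
          · exact hca'
          · exact hd
    refine ⟨insert i T, by rw [Finset.card_insert_of_notMem hiT, hT], ?_, ?_⟩
    · intro j hj
      rcases Finset.mem_insert.1 hj with rfl | hj
      · obtain ⟨a, ha, hav⟩ := hsplit false
        obtain ⟨b, hb, hbv⟩ := hsplit true
        exact ⟨a, ha, b, hb, colex_lt_of (hagree a ha b hb) hav hbv,
          topDiff_eq (hagree a ha b hb) hav hbv⟩
      · obtain ⟨a, ha, b, hb, h⟩ := hlev j hj
        exact ⟨a, (Finset.mem_filter.1 ha).1, b, (Finset.mem_filter.1 hb).1, h⟩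
    · intro j hj k hk hjk
      rcases Finset.mem_insert.1 hk with hk' | hk'
      · rcases Finset.mem_insert.1 hj with hj' | hj'
        · exact absurd hjk (by simp [hj', hk'])
        · exact hk' ▸ htop j hj'
      · rcases Finset.mem_insert.1 hj with hj' | hj'
        · exact absurd hjk (not_lt.2 (hj' ▸ (hTlt k hk').le))
        · obtain ⟨a, h1, h2, h3⟩ := hpair j hj' k hk' hjk
          exact ⟨a, h1, fun l => (Finset.mem_filter.1 (h2 l)).1, h3⟩

/-- The two levels of a triple come in an order that cannot be controlled; judging decreasing gaps
after reversal makes the order irrelevant. -/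
theorem hits_three {Q : (Fin 2 → V) → Prop} {R : (Fin 3 → Colex (V → Bool)) → Prop}
    (hmono : ∀ a, StrictMono (gaps a) → Q (gaps a) → R a)
    (hanti : ∀ a, StrictAnti (gaps a) → Q (gaps a ∘ Fin.rev) → R a) {t : ℕ}
    (h : Hits Q (t + 1)) : Hits R (2 ^ t + 1) := by
  intro S hS
  obtain ⟨T, hT, -, hpair⟩ := exists_levels t S hS
  obtain ⟨u, hu, huT, hQ⟩ := h T hT.ge
  have hlt : u 0 < u 1 := hu (by decide)
  obtain ⟨a, ha, haS, hg | hg⟩ := hpair _ (huT 0) _ (huT 1) hlt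
  · refine ⟨a, ha, haS, hmono a ?_ ?_⟩
    · rw [hg, Fin.strictMono_iff_lt_succ]
      intro k
      fin_cases k
      exact hlt
    · convert hQ using 1
      rw [hg]
      funext k
      fin_cases k <;> rfl
  · refine ⟨a, ha, haS, hanti a ?_ ?_⟩
    · rw [hg, Fin.strictAnti_iff_succ_lt]
      intro k
      fin_cases k
      exact hlt
    · convert hQ using 1
      rw [hg]
      funext k
      fin_cases k <;> rfl

theorem hits_stepUp_two {E : (Fin 2 → V) → Prop} {t : ℕ} (h : Hits E (t + 1)) :
    Hits (stepUp E) (2 ^ t + 1) :=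
  hits_three (fun _ ha => (stepUp_of_strictMono le_rfl ha).2)
    (fun _ ha => (stepUp_of_strictAnti le_rfl ha).2) h

theorem hits_not_stepUp_two {E : (Fin 2 → V) → Prop} {t : ℕ}
    (h : Hits (fun u => ¬ E u) (t + 1)) : Hits (fun a => ¬ stepUp E a) (2 ^ t + 1) :=
  hits_three (Q := fun u => ¬ E u) (fun _ ha => mt (stepUp_of_strictMono le_rfl ha).1)
    (fun _ ha => mt (stepUp_of_strictAnti le_rfl ha).1) h

/-! ### Monotone runs of gaps, and stepping up from uniformity at least 3. -/

section Runs

variable {a : ℕ → Colex (V → Bool)} {m : ℕ}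

/-- Along an increasing run the gap between two words is the last one passed over. So any chosen
gaps of the run form the gap sequence of a tuple: the first word of the run, then the word just
after each chosen gap. -/
theorem exists_tuple_of_increasing_run (ha : ∀ i j, i < j → j < m → a i < a j) {h L r s : ℕ}
    (hL : L < m) (hs : h + s ≤ L)
    (hd : ∀ k, h ≤ k → k + 1 < L → topDiff (a k) (a (k + 1)) < topDiff (a (k + 1)) (a (k + 2)))
    {Q : (Fin r → V) → Prop} (hQ : Hits Q s) :
    ∃ b : Fin (r + 1) → Colex (V → Bool), StrictMono b ∧ (∀ k, ∃ i < m, b k = a i) ∧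
      StrictMono (gaps b) ∧ Q (gaps b) := by
  classical
  set d : ℕ → V := fun k => topDiff (a k) (a (k + 1)) with hdd
  have hmono : ∀ i j, h ≤ i → i < j → j < L → d i < d j := by
    intro i j hi hij
    induction j, hij using Nat.le_induction with
    | base => intro hj; exact hd i hi hj
    | succ j hij ih => intro hj; exact (ih (by omega)).trans (hd j (by omega) hj)
  have hrun : ∀ p q, h ≤ p → p ≤ q → q < L → topDiff (a p) (a (q + 1)) = d q := by
    intro p q hp hpq
    induction q, hpq using Nat.le_induction with
    | base => intro _; rfl
    | succ q hpq ih =>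
      intro hq
      have ih' := ih (by omega)
      refine topDiff_of_lt (ha _ _ (by omega) (by omega)) (ha _ _ (by omega) (by omega)) ?_
      rw [ih']
      exact hd q (by omega) hq
  have hinj : Set.InjOn d (Finset.Ico h L : Finset ℕ) := by
    intro i hi j hj hij
    simp only [Finset.coe_Ico, Set.mem_Ico] at hi hj
    rcases lt_trichotomy i j with hlt | heq | hgt
    · exact absurd hij (hmono i j hi.1 hlt hj.2).ne
    · exact heq
    · exact absurd hij (hmono j i hj.1 hgt hi.2).ne'
  obtain ⟨u, hu, huT, hQu⟩ := hQ ((Finset.Ico h L).image d) (by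
    rw [Finset.card_image_of_injOn hinj, Nat.card_Ico]; omega)
  have hex : ∀ k, ∃ i, h ≤ i ∧ i < L ∧ d i = u k := by
    intro k
    obtain ⟨i, hi, hik⟩ := Finset.mem_image.1 (huT k)
    rw [Finset.mem_Ico] at hi
    exact ⟨i, hi.1, hi.2, hik⟩
  choose i hih hiL hiu using hex
  have himono : ∀ k l, k < l → i k < i l := by
    intro k l hkl
    by_contra hcon
    have hlt := hu hkl
    rw [← hiu k, ← hiu l] at hlt
    rcases (not_lt.1 hcon).lt_or_eq with h' | h'
    · exact lt_asymm hlt (hmono _ _ (hih l) h' (hiL k))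
    · rw [h'] at hlt
      exact lt_irrefl _ hlt
  set e : Fin (r + 1) → ℕ := Fin.cases h (fun k => i k + 1) with he
  have he0 : e 0 = h := rfl
  have hes : ∀ k : Fin r, e k.succ = i k + 1 := fun k => rfl
  have hec : ∀ k : Fin r, h ≤ e k.castSucc ∧ e k.castSucc ≤ i k := by
    intro k
    rcases Fin.eq_zero_or_eq_succ k.castSucc with h0 | ⟨j, hj⟩
    · rw [h0, he0]
      exact ⟨le_rfl, hih k⟩
    · rw [hj, hes]
      have hjk : j < k := by
        have := congrArg Fin.val hj
        simp only [Fin.val_castSucc, Fin.val_succ] at this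
        exact Fin.lt_def.2 (by omega)
      have := himono j k hjk
      have := hih j
      omega
  have hem : ∀ k, e k < m := by
    intro k
    rcases Fin.eq_zero_or_eq_succ k with rfl | ⟨j, rfl⟩
    · rw [he0]; omega
    · rw [hes]
      have := hiL j
      omega
  have hg : gaps (fun k => a (e k)) = u := by
    funext k
    show topDiff (a (e k.castSucc)) (a (e k.succ)) = u k
    rw [hes, hrun _ _ (hec k).1 (hec k).2 (hiL k), hiu]
  refine ⟨fun k => a (e k), ?_, fun k => ⟨e k, hem k, rfl⟩, ?_, ?_⟩
  · rw [Fin.strictMono_iff_lt_succ]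
    intro k
    refine ha _ _ ?_ (hem _)
    rw [hes]
    have := (hec k).2
    omega
  · rw [hg]; exact hu
  · rw [hg]; exact hQu

/-- Here the gap between two words is the first one passed over, so the tuple takes the word just
before each chosen gap and then the last word. The gaps appear in reverse order, whence `Fin.rev`.
-/
theorem exists_tuple_of_decreasing_run (ha : ∀ i j, i < j → j < m → a i < a j) {h L r s : ℕ}
    (hL : L < m) (hs : h + s ≤ L)
    (hd : ∀ k, h ≤ k → k + 1 < L → topDiff (a (k + 1)) (a (k + 2)) < topDiff (a k) (a (k + 1)))
    {Q : (Fin r → V) → Prop} (hQ : Hits Q s) :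
    ∃ b : Fin (r + 1) → Colex (V → Bool), StrictMono b ∧ (∀ k, ∃ i < m, b k = a i) ∧
      StrictAnti (gaps b) ∧ Q (gaps b ∘ Fin.rev) := by
  classical
  set d : ℕ → V := fun k => topDiff (a k) (a (k + 1)) with hdd
  have hanti : ∀ i j, h ≤ i → i < j → j < L → d j < d i := by
    intro i j hi hij
    induction j, hij using Nat.le_induction with
    | base => intro hj; exact hd i hi hj
    | succ j hij ih => intro hj; exact (hd j (by omega) hj).trans (ih (by omega))
  have hrun : ∀ p q, h ≤ p → p ≤ q → q < L → topDiff (a p) (a (q + 1)) = d p := by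
    intro p q hp hpq
    induction q, hpq using Nat.le_induction with
    | base => intro _; rfl
    | succ q hpq ih =>
      intro hq
      have ih' := ih (by omega)
      refine (topDiff_of_gt (ha _ _ (by omega) (by omega))
        (ha (q + 1) _ (by omega) (by omega)) ?_).trans ih'
      rw [ih']
      exact hanti p (q + 1) hp (by omega) hq
  have hinj : Set.InjOn d (Finset.Ico h L : Finset ℕ) := by
    intro i hi j hj hij
    simp only [Finset.coe_Ico, Set.mem_Ico] at hi hj
    rcases lt_trichotomy i j with hlt | heq | hgt
    · exact absurd hij (hanti i j hi.1 hlt hj.2).ne'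
    · exact heq
    · exact absurd hij (hanti j i hj.1 hgt hi.2).ne
  obtain ⟨u, hu, huT, hQu⟩ := hQ ((Finset.Ico h L).image d) (by
    rw [Finset.card_image_of_injOn hinj, Nat.card_Ico]; omega)
  have hex : ∀ k, ∃ i, h ≤ i ∧ i < L ∧ d i = u (Fin.rev k) := by
    intro k
    obtain ⟨i, hi, hik⟩ := Finset.mem_image.1 (huT (Fin.rev k))
    rw [Finset.mem_Ico] at hi
    exact ⟨i, hi.1, hi.2, hik⟩
  choose i hih hiL hiu using hex
  have himono : ∀ k l, k < l → i k < i l := by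
    intro k l hkl
    by_contra hcon
    have hlt := hu (Fin.rev_lt_rev.2 hkl)
    rw [← hiu k, ← hiu l] at hlt
    rcases (not_lt.1 hcon).lt_or_eq with h' | h'
    · exact lt_asymm hlt (hanti _ _ (hih l) h' (hiL k))
    · rw [h'] at hlt
      exact lt_irrefl _ hlt
  set e : Fin (r + 1) → ℕ := Fin.lastCases L i with he
  have hel : e (Fin.last r) = L := by simp [he]
  have hec : ∀ k : Fin r, e k.castSucc = i k := fun k => by simp [he]
  have hes : ∀ k : Fin r, i k < e k.succ ∧ e k.succ ≤ L := by
    intro k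
    rcases Fin.eq_castSucc_or_eq_last k.succ with ⟨j, hj⟩ | h0
    · rw [hj, hec]
      have hjk : k < j := by
        have := congrArg Fin.val hj
        simp only [Fin.val_castSucc, Fin.val_succ] at this
        exact Fin.lt_def.2 (by omega)
      exact ⟨himono k j hjk, (hiL j).le⟩
    · rw [h0, hel]
      exact ⟨hiL k, le_rfl⟩
  have hem : ∀ k, e k < m := by
    intro k
    rcases Fin.eq_castSucc_or_eq_last k with ⟨j, rfl⟩ | rfl
    · rw [hec]
      exact (hiL j).trans hL
    · rw [hel]; exact hL
  have hg : gaps (fun k => a (e k)) = u ∘ Fin.rev := by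
    funext k
    show topDiff (a (e k.castSucc)) (a (e k.succ)) = u (Fin.rev k)
    obtain ⟨h1, h2⟩ := hes k
    obtain ⟨q, hq⟩ : ∃ q, e k.succ = q + 1 := ⟨e k.succ - 1, by omega⟩
    rw [hec, hq, hrun _ _ (hih k) (by omega) (by omega), hiu]
  refine ⟨fun k => a (e k), ?_, fun k => ⟨e k, hem k, rfl⟩, ?_, ?_⟩
  · rw [Fin.strictMono_iff_lt_succ]
    intro k
    refine ha _ _ ?_ (hem _)
    rw [hec]
    exact (hes k).1
  · rw [hg]; exact hu.comp_strictAnti Fin.rev_strictAnti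
  · rw [hg]
    convert hQu using 1
    funext k
    simp

end Runs

/-- Ascents propagate, so the comparison at index `s` decides: an ascent there forces ascents
afterwards, a descent there excludes ascents before. -/
theorem increasing_or_decreasing_run {α : Type*} [LinearOrder α] {d : ℕ → α} {s r : ℕ}
    (hne : ∀ k, k + 1 < s + s + r → d k ≠ d (k + 1))
    (hd : ∀ k, k < s + s → d k < d (k + 1) → d (k + 1) < d (k + 2)) :
    (∀ k, s ≤ k → k + 1 < s + s → d k < d (k + 1)) ∨ (∀ k, 0 ≤ k → k + 1 < s → d (k + 1) < d k) := by
  have hprop : ∀ k l, k ≤ l → l < s + s → d k < d (k + 1) → d l < d (l + 1) := by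
    intro k l hkl
    induction l, hkl using Nat.le_induction with
    | base => intro _ h; exact h
    | succ l hkl ih => intro hl h; exact hd l (by omega) (ih (by omega) h)
  by_cases h : d s < d (s + 1)
  · exact Or.inl fun k hk hk' => hprop s k hk (by omega) h
  · refine Or.inr fun k _ hk => lt_of_le_of_ne (not_lt.1 fun hlt => h ?_) (hne k (by omega)).symm
    exact hprop k s (by omega) (by omega) hlt

theorem exists_increasing_sequence {α : Type*} [LinearOrder α] (S : Finset α) {m : ℕ} (hm : 0 < m)
    (hS : m ≤ S.card) :
    ∃ a : ℕ → α, (∀ i j, i < j → j < m → a i < a j) ∧ ∀ i < m, a i ∈ S := by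
  refine ⟨fun i => if h : i < m then S.orderEmbOfCardLe hS ⟨i, h⟩ else
    S.orderEmbOfCardLe hS ⟨0, hm⟩, fun i j hij hj => ?_, fun i hi => ?_⟩
  · simp only [hj, hij.trans hj, dite_true]
    exact (S.orderEmbOfCardLe hS).strictMono (Fin.mk_lt_mk.2 hij)
  · simp only [hi, dite_true]
    exact S.orderEmbOfCardLe_mem hS _

theorem gaps_shift {a : ℕ → Colex (V → Bool)} (p : ℕ) {r : ℕ} (k : Fin r) :
    gaps (fun k : Fin (r + 1) => a (p + k)) k = topDiff (a (p + k)) (a (p + k + 1)) := rfl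

/-- In a clique, an ascent of gaps followed by a descent would start a tuple that is not monotone
(this needs three gaps) and whose first comparison goes up, hence a non-edge. So ascents propagate,
and `¬ E` is found in a monotone run of `s` gaps. The summand `r` leaves room for windows of `r + 1`
words. -/
theorem hits_not_stepUp {r s : ℕ} (hr : 3 ≤ r) {E : (Fin r → V) → Prop}
    (h : Hits (fun u => ¬ E u) s) : Hits (fun a => ¬ stepUp E a) (s + s + r + 1) := by
  intro S hS
  obtain ⟨a, ha, haS⟩ := exists_increasing_sequence S (by omega) hS
  by_contra hcon
  push Not at hcon
  have hd : ∀ k, k < s + s → topDiff (a k) (a (k + 1)) < topDiff (a (k + 1)) (a (k + 2)) →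
      topDiff (a (k + 1)) (a (k + 2)) < topDiff (a (k + 2)) (a (k + 3)) := by
    intro p hp hlt
    refine lt_of_le_of_ne (not_lt.1 fun hgt => ?_)
      (topDiff_ne (ha _ _ (by omega) (by omega)) (ha _ _ (by omega) (by omega)))
    have hb := hcon (fun k : Fin (r + 1) => a (p + k))
      (fun i j hij => ha _ _ (by simpa using hij) (by have := j.2; omega))
      (fun k => haS _ (by have := k.2; omega))
    rcases hb with ⟨hb, -⟩ | ⟨hb, -⟩ | ⟨-, -, i, j, hi, hj, hb⟩
    · have := hb (show (⟨1, by omega⟩ : Fin r) < ⟨2, by omega⟩ by simp)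
      exact lt_asymm hgt this
    · have := hb (show (⟨0, by omega⟩ : Fin r) < ⟨1, by omega⟩ by simp)
      exact lt_asymm hlt this
    · rw [gaps_shift, gaps_shift, hi, hj] at hb
      exact lt_asymm hlt hb
  rcases increasing_or_decreasing_run (r := r) (d := fun k => topDiff (a k) (a (k + 1))) (fun k hk =>
    topDiff_ne (ha _ _ (by omega) (by omega)) (ha _ _ (by omega) (by omega))) hd with hrun | hrun
  · obtain ⟨b, hb, hbm, hg, hE⟩ := exists_tuple_of_increasing_run ha (by omega) le_rfl hrun h
    refine hE ((stepUp_of_strictMono (by omega) hg).1 (hcon b hb fun k => ?_))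
    obtain ⟨i, hi, hik⟩ := hbm k
    exact hik ▸ haS i hi
  · obtain ⟨b, hb, hbm, hg, hE⟩ := exists_tuple_of_decreasing_run ha (by omega)
      (zero_add s).le hrun h
    refine hE ((stepUp_of_strictAnti (by omega) hg).1 (hcon b hb fun k => ?_))
    obtain ⟨i, hi, hik⟩ := hbm k
    exact hik ▸ haS i hi

theorem hits_stepUp {r s : ℕ} (hr : 3 ≤ r) {E : (Fin r → V) → Prop}
    (h : Hits E s) : Hits (stepUp E) (s + s + r + 1) := by
  intro S hS
  obtain ⟨a, ha, haS⟩ := exists_increasing_sequence S (by omega) hS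
  by_contra hcon
  push Not at hcon
  have hd : ∀ k, k < s + s → topDiff (a (k + 1)) (a (k + 2)) < topDiff (a k) (a (k + 1)) →
      topDiff (a (k + 2)) (a (k + 3)) < topDiff (a (k + 1)) (a (k + 2)) := by
    intro p hp hlt
    refine lt_of_le_of_ne (not_lt.1 fun hgt => ?_)
      (topDiff_ne (ha _ _ (by omega) (by omega)) (ha _ _ (by omega) (by omega))).symm
    refine hcon (fun k : Fin (r + 1) => a (p + k))
      (fun i j hij => ha _ _ (by simpa using hij) (by have := j.2; omega))
      (fun k => haS _ (by have := k.2; omega)) (Or.inr (Or.inr ⟨fun hb => ?_, fun hb => ?_,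
        ⟨0, by omega⟩, ⟨1, by omega⟩, rfl, rfl, hlt⟩))
    · have := hb (show (⟨0, by omega⟩ : Fin r) < ⟨1, by omega⟩ by simp)
      exact lt_asymm hlt this
    · have := hb (show (⟨1, by omega⟩ : Fin r) < ⟨2, by omega⟩ by simp)
      exact lt_asymm hgt this
  have hne : ∀ k, k + 1 < s + s + r → topDiff (a k) (a (k + 1)) ≠ topDiff (a (k + 1)) (a (k + 2)) :=
    fun k hk => topDiff_ne (ha _ _ (by omega) (by omega)) (ha _ _ (by omega) (by omega))
  -- In an independent set it is the descents that propagate, since a descent followed by an ascent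
  -- yields an edge; hence the dual order.
  rcases increasing_or_decreasing_run (α := Vᵒᵈ) (r := r)
    (d := fun k => OrderDual.toDual (topDiff (V := V) (a k) (a (k + 1)))) hne hd with hrun | hrun
  · obtain ⟨b, hb, hbm, hg, hE⟩ := exists_tuple_of_decreasing_run ha (by omega) le_rfl hrun h
    refine hcon b hb (fun k => ?_) ((stepUp_of_strictAnti (by omega) hg).2 hE)
    obtain ⟨i, hi, hik⟩ := hbm k
    exact hik ▸ haS i hi
  · obtain ⟨b, hb, hbm, hg, hE⟩ := exists_tuple_of_increasing_run ha (by omega)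
      (zero_add s).le hrun h
    refine hcon b hb (fun k => ?_) ((stepUp_of_strictMono (by omega) hg).2 hE)
    obtain ⟨i, hi, hik⟩ := hbm k
    exact hik ▸ haS i hi

end Tree

/-! ### Semi-algebraic predicates and their homogeneous stepping-up. -/

/-- A predicate on real vectors that is determined by the signs of finitely many polynomials. -/
def IsSemialgPred {σ : Type*} (A : (σ → ℝ) → Prop) : Prop :=
  ∃ s : Finset (MvPolynomial σ ℝ), ∀ x y,
    (∀ f ∈ s, SignType.sign (MvPolynomial.eval x f) = SignType.sign (MvPolynomial.eval y f)) →
      A x → A y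

namespace IsSemialgPred

variable {σ τ : Type*} {A B : (σ → ℝ) → Prop}

theorem const (p : Prop) : IsSemialgPred fun _ : σ → ℝ => p :=
  ⟨∅, fun _ _ _ h => h⟩

theorem not (hA : IsSemialgPred A) : IsSemialgPred fun x => ¬ A x := by
  obtain ⟨s, hs⟩ := hA
  exact ⟨s, fun x y h hx hy => hx (hs y x (fun f hf => (h f hf).symm) hy)⟩

theorem and (hA : IsSemialgPred A) (hB : IsSemialgPred B) :
    IsSemialgPred fun x => A x ∧ B x := by
  classical
  obtain ⟨s, hs⟩ := hA
  obtain ⟨t, ht⟩ := hB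
  exact ⟨s ∪ t, fun x y h hx => ⟨hs x y (fun f hf => h f (Finset.mem_union_left _ hf)) hx.1,
    ht x y (fun f hf => h f (Finset.mem_union_right _ hf)) hx.2⟩⟩

theorem or (hA : IsSemialgPred A) (hB : IsSemialgPred B) :
    IsSemialgPred fun x => A x ∨ B x := by
  have := (hA.not.and hB.not).not
  simpa only [not_and_or, not_not] using this

theorem all {ι : Type*} [Finite ι] {A : ι → (σ → ℝ) → Prop} (hA : ∀ i, IsSemialgPred (A i)) :
    IsSemialgPred fun x => ∀ i, A i x := by
  classical
  cases nonempty_fintype ι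
  choose s hs using hA
  exact ⟨Finset.univ.biUnion s, fun x y h hx i => hs i x y (fun f hf => h f
    (Finset.mem_biUnion.2 ⟨i, Finset.mem_univ _, hf⟩)) (hx i)⟩

theorem ex {ι : Type*} [Finite ι] {A : ι → (σ → ℝ) → Prop} (hA : ∀ i, IsSemialgPred (A i)) :
    IsSemialgPred fun x => ∃ i, A i x := by
  have := (all fun i => (hA i).not).not
  simpa only [not_forall, not_not] using this

theorem pos (f : MvPolynomial σ ℝ) : IsSemialgPred fun x => 0 < MvPolynomial.eval x f :=
  ⟨{f}, fun x y h hx => by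
    show 0 < MvPolynomial.eval y f
    have hx' : 0 < MvPolynomial.eval x f := hx
    rw [← sign_eq_one_iff] at hx' ⊢
    rw [← h f (Finset.mem_singleton_self _), hx']⟩

theorem comp (hA : IsSemialgPred A) (g : σ → MvPolynomial τ ℝ) :
    IsSemialgPred fun y => A fun i => MvPolynomial.eval y (g i) := by
  classical
  obtain ⟨s, hs⟩ := hA
  refine ⟨s.image (MvPolynomial.bind₁ g), fun x y h hx => hs _ _ (fun f hf => ?_) hx⟩
  have key : ∀ z : τ → ℝ, MvPolynomial.eval (fun i => MvPolynomial.eval z (g i)) f =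
      MvPolynomial.eval z (MvPolynomial.bind₁ g f) := by
    intro z
    have := MvPolynomial.eval₂Hom_bind₁ (RingHom.id ℝ) z g f
    exact this.symm
  rw [key, key]
  exact h _ (Finset.mem_image_of_mem _ hf)

end IsSemialgPred

/-- A relation on `r` vectors that is unaffected by rescaling each vector by a positive factor. -/
def ScaleInvariant {r : ℕ} {κ : Type*} (A : (Fin r → κ → ℝ) → Prop) : Prop :=
  ∀ (c : Fin r → ℝ) (x : Fin r → κ → ℝ), (∀ k, 0 < c k) →
    (A (fun k l => c k * x k l) ↔ A x)

/-- The vertices can be placed at points with leading coordinate `1` such that, on increasing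
tuples, `E` agrees with `A` in a neighbourhood of the corresponding tuple of points. -/
def Realizes {r : ℕ} {κ : Type*} (A : (Fin r → Option κ → ℝ) → Prop) {V : Type*} [LinearOrder V]
    (E : (Fin r → V) → Prop) : Prop :=
  ∃ q : V → Option κ → ℝ, (∀ v, q v none = 1) ∧
    ∀ u : Fin r → V, StrictMono u → ∀ᶠ x in 𝓝 (fun k => q (u k)), (E u ↔ A x)

section StepUpPred

variable {r : ℕ} {κ : Type*}

/-- Homogenised difference of consecutive points. -/
def homDiff (y : Fin (r + 1) → Option (Option κ) → ℝ) (k : Fin r) (l : Option κ) : ℝ :=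
  y k.castSucc none * y k.succ (some l) - y k.succ none * y k.castSucc (some l)

/-- Homogenised comparison of the `i`-th and `j`-th leading differences. -/
def gapForm (y : Fin (r + 1) → Option (Option κ) → ℝ) (i j : Fin r) : ℝ :=
  (y i.castSucc none * y i.succ none) * homDiff y j none -
    2 * ((y j.castSucc none * y j.succ none) * homDiff y i none)

/-- The relation on points that corresponds to `stepUp`. -/
def stepUpPred (A : (Fin r → Option κ → ℝ) → Prop)
    (y : Fin (r + 1) → Option (Option κ) → ℝ) : Prop :=
  ((∀ i j : Fin r, i < j → 0 < gapForm y i j) ∧ A (homDiff y)) ∨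
  ((∀ i j : Fin r, i < j → 0 < gapForm y j i) ∧ A (fun k => homDiff y k.rev)) ∨
    (¬ (∀ i j : Fin r, i < j → 0 < gapForm y i j) ∧
     ¬ (∀ i j : Fin r, i < j → 0 < gapForm y j i) ∧
      ∃ i j : Fin r, i.val = 0 ∧ j.val = 1 ∧ 0 < gapForm y j i)

theorem homDiff_scale (c : Fin (r + 1) → ℝ) (y : Fin (r + 1) → Option (Option κ) → ℝ)
    (k : Fin r) (l : Option κ) :
    homDiff (fun k l => c k * y k l) k l = c k.castSucc * c k.succ * homDiff y k l := by
  simp only [homDiff]; ring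

theorem gapForm_scale_pos {c : Fin (r + 1) → ℝ} (hc : ∀ k, 0 < c k)
    (y : Fin (r + 1) → Option (Option κ) → ℝ) (i j : Fin r) :
    0 < gapForm (fun k l => c k * y k l) i j ↔ 0 < gapForm y i j := by
  have h : gapForm (fun k l => c k * y k l) i j =
      (c i.castSucc * c i.succ * c j.castSucc * c j.succ) * gapForm y i j := by
    simp only [gapForm, homDiff]; ring
  have hpos : 0 < c i.castSucc * c i.succ * c j.castSucc * c j.succ := by
    have := hc i.castSucc; have := hc i.succ; have := hc j.castSucc; have := hc j.succ
    positivity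
  rw [h, mul_pos_iff_of_pos_left hpos]

/-- `homDiff` is linear in each of its two points, so rescaling the points rescales each difference
by a positive factor, which `A` ignores. -/
theorem ScaleInvariant.stepUpPred {A : (Fin r → Option κ → ℝ) → Prop} (hA : ScaleInvariant A) :
    ScaleInvariant (stepUpPred A) := by
  intro c y hc
  have h1 : A (homDiff (fun k l => c k * y k l)) ↔ A (homDiff y) := by
    rw [← hA (fun k => c k.castSucc * c k.succ) (homDiff y) fun k => mul_pos (hc _) (hc _)]
    simp only [← homDiff_scale]
  have h2 : A (fun k => homDiff (fun k l => c k * y k l) k.rev) ↔ A fun k => homDiff y k.rev := by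
    rw [← hA (fun k => c k.rev.castSucc * c k.rev.succ) (fun k => homDiff y k.rev)
      fun k => mul_pos (hc _) (hc _)]
    simp only [← homDiff_scale]
  simp only [_root_.stepUpPred, gapForm_scale_pos hc, h1, h2]

theorem IsSemialgPred.stepUpPred {A : (Fin r → Option κ → ℝ) → Prop}
    (hA : IsSemialgPred fun x : Fin r × Option κ → ℝ => A fun k l => x (k, l)) :
    IsSemialgPred fun x : Fin (r + 1) × Option (Option κ) → ℝ =>
      stepUpPred A fun k l => x (k, l) := by
  let X : Fin (r + 1) × Option (Option κ) → MvPolynomial (Fin (r + 1) × Option (Option κ)) ℝ :=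
    MvPolynomial.X
  let P : Fin r → Option κ → MvPolynomial (Fin (r + 1) × Option (Option κ)) ℝ := fun k l =>
    X (k.castSucc, none) * X (k.succ, some l) - X (k.succ, none) * X (k.castSucc, some l)
  have hP : ∀ (x : Fin (r + 1) × Option (Option κ) → ℝ) k l,
      MvPolynomial.eval x (P k l) = homDiff (fun k l => x (k, l)) k l := by
    intro x k l
    simp [P, X, homDiff]
  have hgap : ∀ i j : Fin r, IsSemialgPred fun x : Fin (r + 1) × Option (Option κ) → ℝ =>
      0 < gapForm (fun k l => x (k, l)) i j := by
    intro i j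
    have := IsSemialgPred.pos ((X (i.castSucc, none) * X (i.succ, none)) * P j none -
      2 * ((X (j.castSucc, none) * X (j.succ, none)) * P i none))
    simpa [hP, gapForm, X] using this
  have h1 := hA.comp fun kl => P kl.1 kl.2
  have h2 := hA.comp fun kl => P kl.1.rev kl.2
  simp only [hP] at h1 h2
  have imp : ∀ {p : Prop} {B : (Fin (r + 1) × Option (Option κ) → ℝ) → Prop},
      IsSemialgPred B → IsSemialgPred fun x => p → B x := by
    intro p B hB
    by_cases hp : p <;> simp only [hp, true_imp_iff, false_imp_iff]
    · exact hB
    · exact IsSemialgPred.const True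
  have hmono := IsSemialgPred.all fun i => IsSemialgPred.all fun j =>
    imp (p := i < j) (hgap i j)
  have hanti := IsSemialgPred.all fun i => IsSemialgPred.all fun j =>
    imp (p := i < j) (hgap j i)
  exact (hmono.and h1).or ((hanti.and h2).or (hmono.not.and (hanti.not.and
    (IsSemialgPred.ex fun i => IsSemialgPred.ex fun j =>
      (IsSemialgPred.const (i.val = 0)).and ((IsSemialgPred.const (j.val = 1)).and (hgap j i))))))

theorem continuous_gapForm (i j : Fin r) :
    Continuous fun y : Fin (r + 1) → Option (Option κ) → ℝ => gapForm y i j := by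
  unfold gapForm homDiff
  fun_prop

end StepUpPred

/-! ### Realizing the stepped-up relation by points. -/

section Realize

variable {V : Type*} [LinearOrder V] [Fintype V] [Nonempty V] {κ : Type*}

/-- The number of smaller elements. -/
def height (v : V) : ℕ := (Finset.univ.filter (· < v)).card

theorem height_strictMono : StrictMono (height : V → ℕ) := by
  intro a b hab
  refine Finset.card_lt_card (Finset.ssubset_iff_of_subset ?_ |>.2 ⟨a, ?_, ?_⟩)
  · intro x hx
    simp only [Finset.mem_filter, Finset.mem_univ, true_and] at hx ⊢
    exact hx.trans hab
  · simpa using hab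
  · simp

/-- The point of a binary word: the weighted sum of its coordinates' points. -/
noncomputable def wordPoint (q : V → Option κ → ℝ) (T : ℝ) (a : Colex (V → Bool)) :
    Option (Option κ) → ℝ
  | none => 1
  | some l => ∑ i, if a i = true then T ^ height i * q i l else 0

theorem homDiff_wordPoint {r : ℕ} (q : V → Option κ → ℝ) (T : ℝ)
    (a : Fin (r + 1) → Colex (V → Bool)) (k : Fin r) (l : Option κ) :
    homDiff (fun k => wordPoint q T (a k)) k l =
      wordPoint q T (a k.succ) (some l) - wordPoint q T (a k.castSucc) (some l) := by
  simp [homDiff, wordPoint]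

/-- Coordinates above `topDiff a b` cancel, and those below carry smaller powers of `T`. -/
theorem tendsto_wordPoint_sub (q : V → Option κ → ℝ) {a b : Colex (V → Bool)} (hab : a < b)
    (l : Option κ) :
    Tendsto (fun T : ℝ => (wordPoint q T b (some l) - wordPoint q T a (some l)) /
      T ^ height (topDiff a b)) atTop (𝓝 (q (topDiff a b) l)) := by
  classical
  obtain ⟨h1, h2, h3⟩ := topDiff_spec hab
  set δ := topDiff a b
  have hsum : q δ l = ∑ i, if i = δ then q δ l else 0 := by simp
  rw [hsum]
  simp only [wordPoint, ← Finset.sum_sub_distrib, Finset.sum_div]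
  refine tendsto_finsetSum _ fun i _ => ?_
  rcases lt_trichotomy i δ with hlt | heq | hgt
  · rw [if_neg hlt.ne]
    have ht : Tendsto (fun T : ℝ => T ^ height i / T ^ height δ) atTop (𝓝 0) :=
      tendsto_pow_div_pow_atTop_zero (height_strictMono hlt)
    have hc := ht.const_mul (((if b i = true then 1 else 0) - (if a i = true then 1 else 0)) * q i l)
    rw [mul_zero] at hc
    refine hc.congr fun T => ?_
    split_ifs <;> ring
  · rw [if_pos heq, heq]
    refine tendsto_const_nhds.congr' ?_
    filter_upwards [eventually_gt_atTop 0] with T hT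
    have : T ^ height δ ≠ 0 := (pow_pos hT _).ne'
    rw [h2, h3]
    simp [this]
  · rw [if_neg hgt.ne', h1 i hgt]
    simp

variable {r : ℕ}

theorem eventually_nhds_scaled_homDiff (q : V → Option κ → ℝ)
    {a : Fin (r + 1) → Colex (V → Bool)} (ha : StrictMono a)
    {B : (Fin r → Option κ → ℝ) → Prop} (hB : ∀ᶠ x in 𝓝 (fun k => q (gaps a k)), B x) :
    ∀ᶠ T : ℝ in atTop, ∀ᶠ y in 𝓝 (fun k => wordPoint q T (a k)),
      B fun k l => (T ^ height (gaps a k))⁻¹ * homDiff y k l := by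
  have ht : Tendsto (fun T : ℝ => fun (k : Fin r) (l : Option κ) =>
      (T ^ height (gaps a k))⁻¹ * homDiff (fun k => wordPoint q T (a k)) k l) atTop
      (𝓝 (fun k => q (gaps a k))) := by
    refine tendsto_pi_nhds.2 fun k => tendsto_pi_nhds.2 fun l => ?_
    have := tendsto_wordPoint_sub q (ha k.castSucc_lt_succ) l
    refine this.congr fun T => ?_
    rw [homDiff_wordPoint, div_eq_inv_mul]
    rfl
  filter_upwards [ht.eventually (eventually_eventually_nhds.2 hB)] with T hT
  have hc : Continuous fun (y : Fin (r + 1) → Option (Option κ) → ℝ) (k : Fin r) (l : Option κ) =>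
      (T ^ height (gaps a k))⁻¹ * homDiff y k l := by
    unfold homDiff
    fun_prop
  exact hc.continuousAt.eventually hT

/-- Leading coordinates are 1, so leading differences grow like the powers of `T` attached to the
gaps. Non-adjacent gaps may coincide; the factor 2 in `gapForm` then gives the limit 1 - 2 instead
of 0, so the sign is stable. -/
theorem eventually_gapForm_pos_iff (q : V → Option κ → ℝ) (hq : ∀ v, q v none = 1)
    {a : Fin (r + 1) → Colex (V → Bool)} (ha : StrictMono a) (i j : Fin r) :
    ∀ᶠ T : ℝ in atTop, ∀ᶠ y in 𝓝 (fun k => wordPoint q T (a k)),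
      (0 < gapForm y i j ↔ gaps a i < gaps a j) := by
  classical
  have key : ∀ (k : Fin r) (v : V), gaps a k ≤ v →
      Tendsto (fun T : ℝ => homDiff (fun k => wordPoint q T (a k)) k none / T ^ height v) atTop
        (𝓝 (if gaps a k = v then 1 else 0)) := by
    intro k v hv
    have h := tendsto_wordPoint_sub q (ha k.castSucc_lt_succ) none
    rw [hq] at h
    rcases hv.eq_or_lt with rfl | hlt
    · rw [if_pos rfl]
      refine h.congr fun T => ?_
      rw [homDiff_wordPoint]
      rfl
    · rw [if_neg hlt.ne]
      have h' := h.mul (tendsto_pow_div_pow_atTop_zero (𝕜 := ℝ) (height_strictMono hlt))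
      rw [mul_zero] at h'
      refine h'.congr' ?_
      filter_upwards [eventually_gt_atTop 0] with T hT
      have h1 : T ^ height (gaps a k) ≠ 0 := (pow_pos hT _).ne'
      rw [homDiff_wordPoint]
      show _ / T ^ height (gaps a k) * _ = _
      field_simp
  have hval : ∀ T, gapForm (fun k => wordPoint q T (a k)) i j =
      homDiff (fun k => wordPoint q T (a k)) j none -
        2 * homDiff (fun k => wordPoint q T (a k)) i none := by
    intro T
    simp [gapForm, wordPoint]
  rcases lt_or_ge (gaps a i) (gaps a j) with hlt | hge
  · have h := (key j _ le_rfl).sub ((key i _ hlt.le).const_mul 2)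
    rw [if_pos rfl, if_neg hlt.ne, mul_zero, sub_zero] at h
    filter_upwards [h.eventually (lt_mem_nhds zero_lt_one), eventually_gt_atTop 0] with T hT hT0
    have hpos : 0 < gapForm (fun k => wordPoint q T (a k)) i j := by
      rw [hval]
      have := mul_pos hT (pow_pos hT0 (height (gaps a j)))
      have h1 : T ^ height (gaps a j) ≠ 0 := (pow_pos hT0 _).ne'
      field_simp at this
      exact this
    filter_upwards [(continuous_gapForm i j).continuousAt.eventually (lt_mem_nhds hpos)] with y hy
    exact iff_of_true hy hlt
  · have h := (key j _ hge).sub ((key i _ le_rfl).const_mul 2)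
    rw [if_pos rfl] at h
    have hneg : (if gaps a j = gaps a i then 1 else 0) - 2 * 1 < (0 : ℝ) := by
      split_ifs <;> norm_num
    filter_upwards [h.eventually (gt_mem_nhds hneg), eventually_gt_atTop 0] with T hT hT0
    have hpos : gapForm (fun k => wordPoint q T (a k)) i j < 0 := by
      rw [hval]
      have := mul_neg_of_neg_of_pos hT (pow_pos hT0 (height (gaps a i)))
      have h1 : T ^ height (gaps a i) ≠ 0 := (pow_pos hT0 _).ne'
      field_simp at this
      exact this
    filter_upwards [(continuous_gapForm i j).continuousAt.eventually (gt_mem_nhds hpos)] with y hy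
    exact iff_of_false (not_lt.2 hy.le) (not_lt.2 hge)

theorem Realizes.stepUp {A : (Fin r → Option κ → ℝ) → Prop} (hA : ScaleInvariant A)
    {E : (Fin r → V) → Prop} (h : Realizes A E) : Realizes (stepUpPred A) (stepUp E) := by
  obtain ⟨q, hq, hE⟩ := h
  have main : ∀ a : Fin (r + 1) → Colex (V → Bool), ∀ᶠ T : ℝ in atTop, StrictMono a →
      ∀ᶠ y in 𝓝 (fun k => wordPoint q T (a k)), (_root_.stepUp E a ↔ stepUpPred A y) := by
    intro a
    by_cases ha : StrictMono a
    swap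
    · exact Eventually.of_forall fun T h => absurd h ha
    have hgap := eventually_all.2 fun i => eventually_all.2 fun j =>
      eventually_gapForm_pos_iff q hq ha i j
    have hfwd : ∀ᶠ T : ℝ in atTop, ∀ᶠ y in 𝓝 (fun k => wordPoint q T (a k)),
        StrictMono (gaps a) → (E (gaps a) ↔ A (homDiff y)) := by
      by_cases hm : StrictMono (gaps a)
      swap
      · exact Eventually.of_forall fun T => Eventually.of_forall fun y h => absurd h hm
      filter_upwards [eventually_nhds_scaled_homDiff q ha (hE _ hm), eventually_gt_atTop 0]
        with T hT hT0
      filter_upwards [hT] with y hy _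
      rw [hy]
      exact hA _ _ fun k => inv_pos.2 (pow_pos hT0 _)
    have hbwd : ∀ᶠ T : ℝ in atTop, ∀ᶠ y in 𝓝 (fun k => wordPoint q T (a k)),
        StrictAnti (gaps a) → (E (gaps a ∘ Fin.rev) ↔ A (fun k => homDiff y k.rev)) := by
      by_cases hm : StrictAnti (gaps a)
      swap
      · exact Eventually.of_forall fun T => Eventually.of_forall fun y h => absurd h hm
      have hB : ∀ᶠ x in 𝓝 (fun k => q (gaps a k)),
          (E (gaps a ∘ Fin.rev) ↔ A fun k => x k.rev) := by
        have hc : Continuous fun (x : Fin r → Option κ → ℝ) (k : Fin r) => x k.rev := by fun_prop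
        exact (hc.tendsto fun k => q (gaps a k)).eventually (hE _ (hm.comp Fin.rev_strictAnti))
      filter_upwards [eventually_nhds_scaled_homDiff q ha hB, eventually_gt_atTop 0]
        with T hT hT0
      filter_upwards [hT] with y hy _
      rw [hy]
      -- Scale invariance removes the powers of `T` that normalise the differences.
      exact hA (fun k => (T ^ height (gaps a k.rev))⁻¹) (fun k => homDiff y k.rev)
        fun k => inv_pos.2 (pow_pos hT0 _)
    filter_upwards [hgap, hfwd, hbwd] with T h1 h2 h3 _
    filter_upwards [eventually_all.2 fun i => eventually_all.2 fun j => h1 i j, h2, h3]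
      with y k1 k2 k3
    simp only [_root_.stepUp, stepUpPred, k1]
    exact or_congr (and_congr_right k2) (or_congr (and_congr_right k3) Iff.rfl)
  have : Finite (Colex (V → Bool)) := inferInstanceAs (Finite (V → Bool))
  -- There are finitely many tuples of words, so one `T` serves them all.
  obtain ⟨T, hT⟩ := (eventually_all.2 main).exists
  exact ⟨wordPoint q T, fun _ => rfl, hT⟩

end Realize

/-! ### From realized relations to lower bounds on `semialgRamsey`. -/

/-- Finite Ramsey theorem for `r`-element sets and two colours. -/
theorem exists_ramsey (r : ℕ) : ∀ n : ℕ, ∃ N : ℕ, ∀ {α : Type} [LinearOrder α] (S : Finset α)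
    (c : Finset α → Prop), N ≤ S.card → ∃ T ⊆ S, T.card = n ∧
      ((∀ e ⊆ T, e.card = r → c e) ∨ (∀ e ⊆ T, e.card = r → ¬ c e)) := by
  classical
  induction r with
  | zero =>
    intro n
    refine ⟨n, fun S c hS => ?_⟩
    obtain ⟨T, hTS, hT⟩ := Finset.exists_subset_card_eq hS
    refine ⟨T, hTS, hT, ?_⟩
    by_cases h : c ∅
    · exact Or.inl fun e _ he => by rwa [Finset.card_eq_zero.1 he]
    · exact Or.inr fun e _ he => by rwa [Finset.card_eq_zero.1 he]
  | succ r ih =>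
    -- Thinning until the colour of an `(r + 1)`-set depends only on its minimum: set the least
    -- element aside, apply the `r`-uniform theorem to the rest, and repeat.
    have step : ∀ m : ℕ, ∃ N : ℕ, ∀ {α : Type} [LinearOrder α] (S : Finset α)
        (c : Finset α → Prop), N ≤ S.card → ∃ T ⊆ S, T.card = m ∧ ∃ χ : α → Prop,
          ∀ x ∈ T, ∀ e ⊆ T, e.card = r → (∀ y ∈ e, x < y) → (c (insert x e) ↔ χ x) := by
      intro m
      induction m with
      | zero => exact ⟨0, fun S c _ => ⟨∅, by simp, rfl, fun _ => True, by simp⟩⟩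
      | succ m ihm =>
        obtain ⟨N₁, hN₁⟩ := ihm
        obtain ⟨N₂, hN₂⟩ := ih N₁
        refine ⟨N₂ + 1, fun S c hS => ?_⟩
        have hne : S.Nonempty := Finset.card_pos.1 (by omega)
        set x := S.min' hne with hx
        have hxS : x ∈ S := Finset.min'_mem _ _
        obtain ⟨T₁, hT₁S, hT₁, hmono⟩ := hN₂ (S.erase x) (fun e => c (insert x e)) (by
          rw [Finset.card_erase_of_mem hxS]; omega)
        obtain ⟨T, hTT, hT, χ, hχ⟩ := hN₁ T₁ c hT₁.ge
        have hlt : ∀ y ∈ T, x < y := by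
          intro y hy
          have hyS := Finset.mem_erase.1 (hT₁S (hTT hy))
          exact lt_of_le_of_ne (Finset.min'_le _ _ hyS.2) hyS.1.symm
        have hxT : x ∉ T := fun h => lt_irrefl _ (hlt x h)
        refine ⟨insert x T, ?_, by rw [Finset.card_insert_of_notMem hxT, hT], ?_⟩
        · intro y hy
          rcases Finset.mem_insert.1 hy with rfl | hy
          · exact hxS
          · exact Finset.mem_of_mem_erase (hT₁S (hTT hy))
        have hsub : ∀ z ∈ insert x T, ∀ e ⊆ insert x T, (∀ y ∈ e, z < y) → e ⊆ T := by
          intro z hz e he hze y hy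
          rcases Finset.mem_insert.1 (he hy) with h | h
          · have hzx := hze y hy
            rw [h] at hzx
            rcases Finset.mem_insert.1 hz with h' | h'
            · exact absurd hzx (by simp [h'])
            · exact absurd hzx (not_lt.2 (hlt z h').le)
          · exact h
        obtain ⟨p, hp⟩ : ∃ p : Prop, ∀ e ⊆ T₁, e.card = r → (c (insert x e) ↔ p) := by
          rcases hmono with h | h
          · exact ⟨True, fun e he hc => iff_true_intro (h e he hc)⟩
          · exact ⟨False, fun e he hc => iff_false_intro (h e he hc)⟩
        refine ⟨fun y => if y = x then p else χ y, fun z hz e he hc hze => ?_⟩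
        have heT := hsub z hz e he hze
        rcases Finset.mem_insert.1 hz with h' | h'
        · subst h'
          beta_reduce
          rw [if_pos rfl]
          exact hp e (heT.trans hTT) hc
        · beta_reduce
          rw [if_neg (hlt z h').ne']
          exact hχ z h' e heT hc hze
    intro n
    obtain ⟨N, hN⟩ := step (n + n)
    refine ⟨N, fun S c hS => ?_⟩
    obtain ⟨T, hTS, hT, χ, hχ⟩ := hN S c hS
    have hmin : ∀ e ⊆ T, e.card = r + 1 → ∃ x ∈ e, (c e ↔ χ x) := by
      intro e he hc
      have hne : e.Nonempty := Finset.card_pos.1 (by omega)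
      refine ⟨e.min' hne, Finset.min'_mem _ _, ?_⟩
      rw [← hχ _ (he (Finset.min'_mem _ hne)) (e.erase (e.min' hne))
        ((Finset.erase_subset _ _).trans he), Finset.insert_erase (Finset.min'_mem _ _)]
      · rw [Finset.card_erase_of_mem (Finset.min'_mem _ _)]; omega
      · intro y hy
        have := Finset.mem_erase.1 hy
        exact lt_of_le_of_ne (Finset.min'_le _ _ this.2) this.1.symm
    have hcard := Finset.card_filter_add_card_filter_not (s := T) χ
    rcases le_or_gt n (T.filter χ).card with h | h
    · obtain ⟨U, hU, hUn⟩ := Finset.exists_subset_card_eq h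
      refine ⟨U, hU.trans ((Finset.filter_subset _ _).trans hTS), hUn, Or.inl fun e he hc => ?_⟩
      obtain ⟨x, hx, hcx⟩ := hmin e (he.trans (hU.trans (Finset.filter_subset _ _))) hc
      exact hcx.2 (Finset.mem_filter.1 (hU (he hx))).2
    · obtain ⟨U, hU, hUn⟩ := Finset.exists_subset_card_eq
        (show n ≤ (T.filter fun x => ¬ χ x).card by omega)
      refine ⟨U, hU.trans ((Finset.filter_subset _ _).trans hTS), hUn, Or.inr fun e he hc => ?_⟩
      obtain ⟨x, hx, hcx⟩ := hmin e (he.trans (hU.trans (Finset.filter_subset _ _))) hc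
      exact fun hce => (Finset.mem_filter.1 (hU (he hx))).2 (hcx.1 hce)

theorem semialgRamsey_mem (r d D m s n : ℕ) (H : UniformHypergraph r
    (Fin (semialgRamsey r d D m s n))) (hH : H.IsSemialgebraic d D m) :
    (∃ S : Finset (Fin (semialgRamsey r d D m s n)), S.card = s ∧ H.IsClique S) ∨
    (∃ S : Finset (Fin (semialgRamsey r d D m s n)), S.card = n ∧ H.IsIndep S) := by
  -- In `ℕ` the infimum of the empty set is 0, so finiteness of the Ramsey number is needed for it
  -- to be attained.
  have hne : {N : ℕ | ∀ H : UniformHypergraph r (Fin N), H.IsSemialgebraic d D m →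
    (∃ S : Finset (Fin N), S.card = s ∧ H.IsClique S) ∨
    (∃ S : Finset (Fin N), S.card = n ∧ H.IsIndep S)}.Nonempty := by
    obtain ⟨N, hN⟩ := exists_ramsey r (max s n)
    refine ⟨N, fun H _ => ?_⟩
    obtain ⟨T, -, hT, h | h⟩ := hN (Finset.univ : Finset (Fin N)) (fun e => e ∈ H.edges) (by simp)
    · obtain ⟨U, hU, hUs⟩ := Finset.exists_subset_card_eq ((le_max_left s n).trans hT.ge)
      exact Or.inl ⟨U, hUs, fun e he hc => h e (he.trans hU) hc⟩
    · obtain ⟨U, hU, hUn⟩ := Finset.exists_subset_card_eq ((le_max_right s n).trans hT.ge)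
      exact Or.inr ⟨U, hUn, fun e he hce => h e (he.trans hU) (H.card_eq e hce) hce⟩
  exact Nat.sInf_mem hne H hH

/-- If the Ramsey number `N` were at most `|V|`, the relation restricted to the first `N` vertices
would contradict its definition. Using exactly `N` vertices avoids any monotonicity in `N`. -/
theorem exists_lt_semialgRamsey {r : ℕ} {κ : Type} [Finite κ]
    {A : (Fin r → Option κ → ℝ) → Prop}
    (hA : IsSemialgPred fun x : Fin r × Option κ → ℝ => A fun k l => x (k, l)) :
    ∃ d D m : ℕ, ∀ (s n : ℕ) {V : Type} [LinearOrder V] [Fintype V] {E : (Fin r → V) → Prop},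
      Realizes A E → Hits (fun u => ¬ E u) s → Hits E n →
        Fintype.card V < semialgRamsey r d D m s n := by
  classical
  cases nonempty_fintype κ
  obtain ⟨P, hP⟩ := hA
  let e : Option κ ≃ Fin (Fintype.card (Option κ)) := Fintype.equivFin _
  let g : Fin P.card ≃ P := P.equivFin.symm
  let f : Fin P.card → MvPolynomial (Fin r × Fin (Fintype.card (Option κ))) ℝ := fun j =>
    MvPolynomial.rename (Prod.map id e) (g j).1
  refine ⟨Fintype.card (Option κ), Finset.univ.sup fun j => (f j).totalDegree, P.card, ?_⟩
  intro s n V _ _ E hreal hs hn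
  by_contra hcon
  set N := semialgRamsey r (Fintype.card (Option κ))
    (Finset.univ.sup fun j => (f j).totalDegree) P.card s n with hN
  let φ : Fin N ↪o V := (Fin.castLEOrderEmb (not_lt.1 hcon)).trans
    (Fintype.orderIsoFinOfCardEq V rfl).toOrderEmbedding
  let H : UniformHypergraph r (Fin N) :=
    { edges := {t | ∃ i : Fin r ↪o Fin N, t = Finset.univ.map i.toEmbedding ∧ E fun k => φ (i k)}
      card_eq := by
        rintro t ⟨i, rfl, -⟩
        simp }
  have hedge : ∀ i : Fin r ↪o Fin N,
      Finset.univ.map i.toEmbedding ∈ H.edges ↔ E fun k => φ (i k) := by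
    intro i
    refine ⟨?_, fun h => ⟨i, rfl, h⟩⟩
    rintro ⟨i', hi', h⟩
    have : i = i' := by
      rw [← OrderEmbedding.range_inj]
      have := congrArg (fun t : Finset (Fin N) => (t : Set (Fin N))) hi'
      simpa using this
    rwa [this]
  have hsemi : H.IsSemialgebraic (Fintype.card (Option κ))
      (Finset.univ.sup fun j => (f j).totalDegree) P.card := by
    obtain ⟨q, -, hq⟩ := hreal
    -- `Φ` accepts the sign patterns attained somewhere on `A`; by `hP` the pattern determines
    -- membership in `A`.
    refine ⟨N, Equiv.refl _, fun v l => q (φ v) (e.symm l), f,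
      fun τ => ∃ x : Fin r × Option κ → ℝ, (A fun k l => x (k, l)) ∧
        ∀ j, SignType.sign (MvPolynomial.eval x (g j).1) = τ j,
      fun j => Finset.le_sup (f := fun j => (f j).totalDegree) (Finset.mem_univ j), fun i => ?_⟩
    have hmap : Finset.univ.map (i.toEmbedding.trans (Equiv.refl (Fin N)).toEmbedding) =
        Finset.univ.map i.toEmbedding := rfl
    rw [hmap, hedge]
    have hA' : (E fun k => φ (i k)) ↔ A fun k => q (φ (i k)) :=
      (hq _ (φ.strictMono.comp i.strictMono)).self_of_nhds
    have hev : ∀ j, MvPolynomial.eval (fun kl : Fin r × Fin (Fintype.card (Option κ)) =>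
        q (φ (i kl.1)) (e.symm kl.2)) (f j) =
        MvPolynomial.eval (fun kl : Fin r × Option κ => q (φ (i kl.1)) kl.2) (g j).1 := by
      intro j
      simp only [f, MvPolynomial.eval_rename]
      congr 2
      funext kl
      simp
    simp only [hev]
    rw [hA']
    constructor
    · exact fun h => ⟨fun kl => q (φ (i kl.1)) kl.2, h, fun j => rfl⟩
    · rintro ⟨x, hx, hτ⟩
      refine hP x (fun kl => q (φ (i kl.1)) kl.2) (fun p hp => ?_) hx
      have := hτ (g.symm ⟨p, hp⟩)
      simpa using this
  have hlift : ∀ (S : Finset (Fin N)) (u : Fin r → V), StrictMono u →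
      (∀ k, u k ∈ S.map φ.toEmbedding) → ∃ i : Fin r ↪o Fin N, (fun k => φ (i k)) = u ∧
        Finset.univ.map i.toEmbedding ⊆ S := by
    intro S u hu huS
    have hex : ∀ k, ∃ i ∈ S, φ i = u k := fun k => by simpa using huS k
    choose i hiS hi using hex
    refine ⟨OrderEmbedding.ofStrictMono i fun k l hkl => ?_, funext hi, fun x hx => ?_⟩
    · have := hu hkl
      rwa [← hi, ← hi, φ.lt_iff_lt] at this
    · obtain ⟨k, -, rfl⟩ := Finset.mem_map.1 hx
      exact hiS k
  rcases semialgRamsey_mem _ _ _ _ s n H hsemi with ⟨S, hS, hcl⟩ | ⟨S, hS, hind⟩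
  · obtain ⟨u, hu, huS, hE⟩ := hs (S.map φ.toEmbedding) (by rw [Finset.card_map, hS])
    obtain ⟨i, rfl, hi⟩ := hlift S u hu huS
    exact hE ((hedge i).1 (hcl _ hi (by simp)))
  · obtain ⟨u, hu, huS, hE⟩ := hn (S.map φ.toEmbedding) (by rw [Finset.card_map, hS])
    obtain ⟨i, rfl, hi⟩ := hlift S u hu huS
    exact hind _ hi ((hedge i).2 hE)

/-! ### The triangle-free incidence graph. -/

/-- For incidences `(x, a, b)` of the line `y = a x + b` with its point of abscissa `x`: the first
point lies on the second line, to the right of the second point, and the first line is less steep. -/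
def IncidenceArrow (p q : ℕ × ℕ × ℕ) : Prop :=
  p.2.1 * p.1 + p.2.2 = q.2.1 * p.1 + q.2.2 ∧ q.1 < p.1 ∧ p.2.1 < q.2.1

/-- Otherwise the lines of `q` and `r`, of different slopes, would both pass through the points of
`p` and `q`, which have different abscissas. -/
theorem IncidenceArrow.not_transitive {p q r : ℕ × ℕ × ℕ} (hpq : IncidenceArrow p q)
    (hqr : IncidenceArrow q r) : ¬ IncidenceArrow p r := by
  intro hpr
  obtain ⟨h1, h2, -⟩ := hpq
  obtain ⟨h3, -, h4⟩ := hqr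
  obtain ⟨h5, -, -⟩ := hpr
  zify at *
  nlinarith [mul_pos (sub_pos.2 h2) (sub_pos.2 h4)]

/-- The forms whose simultaneous positivity expresses `IncidenceArrow` on homogeneous points. -/
def arrowForm (i : Fin 4) (u v : Option (Fin 3) → ℝ) : ℝ :=
  ![2 * (v none * (u (some 1) * u (some 0) + u (some 2) * u none) -
        u none * (v (some 1) * u (some 0) + v (some 2) * u none)) + u none * u none * v none,
    u none * u none * v none - 2 * (v none * (u (some 1) * u (some 0) + u (some 2) * u none) -
        u none * (v (some 1) * u (some 0) + v (some 2) * u none)),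
    2 * (u (some 0) * v none - v (some 0) * u none) - u none * v none,
    2 * (v (some 1) * u none - u (some 1) * v none) - u none * v none] i

/-- The relation on pairs of homogeneous points defining the incidence graph. -/
def incidencePred (y : Fin 2 → Option (Fin 3) → ℝ) : Prop :=
  (∀ i, 0 < arrowForm i (y 0) (y 1)) ∨ (∀ i, 0 < arrowForm i (y 1) (y 0))

theorem arrowForm_scale_pos {c d : ℝ} (hc : 0 < c) (hd : 0 < d) (i : Fin 4)
    (u v : Option (Fin 3) → ℝ) :
    0 < arrowForm i (fun l => c * u l) (fun l => d * v l) ↔ 0 < arrowForm i u v := by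
  have h : ∃ e : ℝ, 0 < e ∧
      arrowForm i (fun l => c * u l) (fun l => d * v l) = e * arrowForm i u v := by
    fin_cases i
    · exact ⟨c * c * d, by positivity, by simp [arrowForm]; ring⟩
    · exact ⟨c * c * d, by positivity, by simp [arrowForm]; ring⟩
    · exact ⟨c * d, by positivity, by simp [arrowForm]; ring⟩
    · exact ⟨c * d, by positivity, by simp [arrowForm]; ring⟩
  obtain ⟨e, he, h⟩ := h
  rw [h, mul_pos_iff_of_pos_left he]

theorem scaleInvariant_incidencePred : ScaleInvariant incidencePred := by
  intro c y hc
  simp only [incidencePred, arrowForm_scale_pos (hc _) (hc _)]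

theorem isSemialgPred_incidencePred : IsSemialgPred fun x : Fin 2 × Option (Fin 3) → ℝ =>
    incidencePred fun k l => x (k, l) := by
  let X : Fin 2 × Option (Fin 3) → MvPolynomial (Fin 2 × Option (Fin 3)) ℝ := MvPolynomial.X
  have h : ∀ (i : Fin 4) (s t : Fin 2), IsSemialgPred fun x : Fin 2 × Option (Fin 3) → ℝ =>
      0 < arrowForm i (fun l => x (s, l)) (fun l => x (t, l)) := by
    intro i s t
    have := IsSemialgPred.pos
      (![2 * (X (t, none) * (X (s, some 1) * X (s, some 0) + X (s, some 2) * X (s, none)) -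
          X (s, none) * (X (t, some 1) * X (s, some 0) + X (t, some 2) * X (s, none))) +
            X (s, none) * X (s, none) * X (t, none),
        X (s, none) * X (s, none) * X (t, none) -
          2 * (X (t, none) * (X (s, some 1) * X (s, some 0) + X (s, some 2) * X (s, none)) -
          X (s, none) * (X (t, some 1) * X (s, some 0) + X (t, some 2) * X (s, none))),
        2 * (X (s, some 0) * X (t, none) - X (t, some 0) * X (s, none)) - X (s, none) * X (t, none),
        2 * (X (t, some 1) * X (s, none) - X (s, some 1) * X (t, none)) -
          X (s, none) * X (t, none)] i)
    fin_cases i <;> simpa [arrowForm, X] using this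
  exact (IsSemialgPred.all fun i => h i 0 1).or (IsSemialgPred.all fun i => h i 1 0)

theorem continuous_arrowForm (i : Fin 4) :
    Continuous fun y : (Option (Fin 3) → ℝ) × (Option (Fin 3) → ℝ) => arrowForm i y.1 y.2 := by
  fin_cases i <;> simp [arrowForm] <;> fun_prop

/-- The homogeneous point of an incidence. -/
def incidencePoint (p : ℕ × ℕ × ℕ) : Option (Fin 3) → ℝ
  | none => 1
  | some i => ![(p.1 : ℝ), p.2.1, p.2.2] i

/-- For an integer `z`, `z = 0` means `-1/2 < z < 1/2` and `0 < z` means `1/2 < z`; doubling clears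
the halves. -/
theorem arrowForm_incidencePoint_pos_iff (p q : ℕ × ℕ × ℕ) :
    (∀ i, 0 < arrowForm i (incidencePoint p) (incidencePoint q)) ↔ IncidenceArrow p q := by
  obtain ⟨x, a, b⟩ := p
  obtain ⟨x', a', b'⟩ := q
  simp only [Fin.forall_fin_succ, IncidenceArrow]
  rw [show Fin.succ (Fin.succ (Fin.succ (0 : Fin 1))) = 3 from rfl]
  simp only [arrowForm, incidencePoint, Fin.isValue, Matrix.cons_val_zero, Matrix.cons_val_one,
    Matrix.cons_val, one_mul, mul_one, Fin.succ_zero_eq_one, Fin.succ_one_eq_two, IsEmpty.forall_iff,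
    and_true]
  constructor
  · rintro ⟨h1, h2, h3, h4⟩
    have h1' : (0 : ℤ) < 2 * (a * x + b - (a' * x + b')) + 1 := by exact_mod_cast h1
    have h2' : (0 : ℤ) < 1 - 2 * (a * x + b - (a' * x + b')) := by exact_mod_cast h2
    have h3' : (0 : ℤ) < 2 * (x - x') - 1 := by exact_mod_cast h3
    have h4' : (0 : ℤ) < 2 * (a' - a) - 1 := by exact_mod_cast h4
    refine ⟨?_, by omega, by omega⟩
    zify
    omega
  · rintro ⟨h1, h2, h3⟩
    have h1' : (a : ℝ) * x + b = a' * x + b' := by exact_mod_cast h1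
    have h2' : (x' : ℝ) + 1 ≤ x := by exact_mod_cast h2
    have h3' : (a : ℝ) + 1 ≤ a' := by exact_mod_cast h3
    refine ⟨?_, ?_, ?_, ?_⟩ <;> linarith

/-- The values at integer points are odd, so their signs persist nearby, as `Realizes` requires. -/
theorem arrowForm_incidencePoint_ne_zero (i : Fin 4) (p q : ℕ × ℕ × ℕ) :
    arrowForm i (incidencePoint p) (incidencePoint q) ≠ 0 := by
  obtain ⟨x, a, b⟩ := p
  obtain ⟨x', a', b'⟩ := q
  have key : ∃ z : ℤ, arrowForm i (incidencePoint (x, a, b)) (incidencePoint (x', a', b')) =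
      ((2 * z + 1 : ℤ) : ℝ) := by
    fin_cases i
    · exact ⟨a * x + b - (a' * x + b'), by simp [arrowForm, incidencePoint]⟩
    · exact ⟨-(a * x + b - (a' * x + b')), by simp [arrowForm, incidencePoint]; ring⟩
    · exact ⟨x - x' - 1, by simp [arrowForm, incidencePoint]; ring⟩
    · exact ⟨a' - a - 1, by simp [arrowForm, incidencePoint]; ring⟩
  obtain ⟨z, hz⟩ := key
  rw [hz]
  exact_mod_cast (by omega : 2 * z + 1 ≠ 0)

theorem eventually_pos_iff {α : Type*} [TopologicalSpace α] {f : α → ℝ} (hf : Continuous f) {a : α}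
    (ha : f a ≠ 0) : ∀ᶠ x in 𝓝 a, (0 < f x ↔ 0 < f a) := by
  rcases ha.lt_or_gt with h | h
  · filter_upwards [hf.continuousAt.eventually (gt_mem_nhds h)] with x hx
    exact iff_of_false (not_lt.2 hx.le) (not_lt.2 h.le)
  · filter_upwards [hf.continuousAt.eventually (lt_mem_nhds h)] with x hx
    exact iff_of_true hx h

/-- The incidence graph as a relation on pairs of vertices labelled by incidences. -/
def incidenceRel {V : Type*} (lab : V → ℕ × ℕ × ℕ) (u : Fin 2 → V) : Prop :=
  IncidenceArrow (lab (u 0)) (lab (u 1)) ∨ IncidenceArrow (lab (u 1)) (lab (u 0))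

theorem realizes_incidenceRel {V : Type*} [LinearOrder V] (lab : V → ℕ × ℕ × ℕ) :
    Realizes incidencePred (incidenceRel lab) := by
  refine ⟨fun v => incidencePoint (lab v), fun v => rfl, fun u _ => ?_⟩
  have h : ∀ s t : Fin 2, ∀ᶠ x in 𝓝 (fun k => incidencePoint (lab (u k))), ∀ i : Fin 4,
      (0 < arrowForm i (x s) (x t) ↔
        0 < arrowForm i (incidencePoint (lab (u s))) (incidencePoint (lab (u t)))) := by
    intro s t
    refine eventually_all.2 fun i => ?_
    have hc : Continuous fun x : Fin 2 → Option (Fin 3) → ℝ => arrowForm i (x s) (x t) :=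
      (continuous_arrowForm i).comp (by fun_prop : Continuous
        fun x : Fin 2 → Option (Fin 3) → ℝ => (x s, x t))
    exact eventually_pos_iff hc (arrowForm_incidencePoint_ne_zero i _ _)
  filter_upwards [h 0 1, h 1 0] with x h1 h2
  simp only [incidencePred, incidenceRel, h1, h2, arrowForm_incidencePoint_pos_iff]

theorem exists_incidenceRel_of_arrow {V : Type*} [LinearOrder V] {lab : V → ℕ × ℕ × ℕ}
    {S : Finset V} {v w : V} (hv : v ∈ S) (hw : w ∈ S) (h : IncidenceArrow (lab v) (lab w)) :
    ∃ u : Fin 2 → V, StrictMono u ∧ (∀ k, u k ∈ S) ∧ incidenceRel lab u := by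
  have hpair : ∀ a b : V, a ∈ S → b ∈ S → a < b →
      StrictMono ![a, b] ∧ ∀ k, (![a, b] : Fin 2 → V) k ∈ S := by
    intro a b ha hb hab
    refine ⟨Fin.strictMono_iff_lt_succ.2 fun k => ?_, fun k => ?_⟩
    · fin_cases k
      exact hab
    · fin_cases k
      · exact ha
      · exact hb
  rcases lt_trichotomy v w with hlt | heq | hgt
  · exact ⟨![v, w], (hpair v w hv hw hlt).1, (hpair v w hv hw hlt).2, Or.inl h⟩
  · rw [heq] at h
    exact absurd h.2.1 (lt_irrefl _)
  · exact ⟨![w, v], (hpair w v hw hv hgt).1, (hpair w v hw hv hgt).2, Or.inr h⟩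

/-- Arrows decrease the abscissa, so a triangle cannot be cyclic; a transitive one is excluded by
`IncidenceArrow.not_transitive`. -/
theorem hits_not_incidenceRel {V : Type*} [LinearOrder V] (lab : V → ℕ × ℕ × ℕ) :
    Hits (fun u => ¬ incidenceRel lab u) 3 := by
  classical
  intro S hS
  by_contra hcon
  push Not at hcon
  have hadj : ∀ v ∈ S, ∀ w ∈ S, v ≠ w →
      IncidenceArrow (lab v) (lab w) ∨ IncidenceArrow (lab w) (lab v) := by
    intro v hv w hw hvw
    wlog hlt : v < w generalizing v w
    · exact (this w hw v hv hvw.symm (lt_of_le_of_ne (not_lt.1 hlt) hvw.symm)).symm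
    refine hcon ![v, w] (Fin.strictMono_iff_lt_succ.2 fun k => ?_) fun k => ?_
    · fin_cases k
      exact hlt
    · fin_cases k
      · exact hv
      · exact hw
  obtain ⟨T, hTS, hT⟩ := Finset.exists_subset_card_eq hS
  obtain ⟨u, v, w, huv, huw, hvw, rfl⟩ := Finset.card_eq_three.1 hT
  have hu : u ∈ S := hTS (by simp)
  have hv : v ∈ S := hTS (by simp)
  have hw : w ∈ S := hTS (by simp)
  rcases hadj u hu v hv huv with h1 | h1 <;> rcases hadj u hu w hw huw with h2 | h2 <;>
    rcases hadj v hv w hw hvw with h3 | h3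
  · exact h1.not_transitive h3 h2
  · exact h2.not_transitive h3 h1
  · exact lt_asymm (h1.2.1.trans h2.2.1) h3.2.1
  · exact h2.not_transitive h1 h3
  · exact h1.not_transitive h2 h3
  · exact lt_asymm (h1.2.1.trans h3.2.1) h2.2.1
  · exact h3.not_transitive h2 h1
  · exact h3.not_transitive h1 h2

/-- In an independent set, the leftmost incidences on their lines number at most `M ^ 3`, the number
of lines. Of the others, each of the `2 * M ^ 3` possible points carries at most one. -/
theorem hits_incidenceRel {V : Type*} [LinearOrder V] {lab : V → ℕ × ℕ × ℕ}
    (hlab : Function.Injective lab) {M : ℕ}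
    (hM : ∀ v, (lab v).1 < M ∧ (lab v).2.1 < M ∧ (lab v).2.2 < M ^ 2) :
    Hits (incidenceRel lab) (3 * M ^ 3 + 1) := by
  classical
  intro S hS
  by_contra hcon
  have hno : ∀ v ∈ S, ∀ w ∈ S, ¬ IncidenceArrow (lab v) (lab w) := fun v hv w hw h =>
    hcon (exists_incidenceRel_of_arrow hv hw h)
  let p : V → Prop := fun v => ∃ w ∈ S, (lab w).2 = (lab v).2 ∧ (lab w).1 < (lab v).1
  have hcard := Finset.card_filter_add_card_filter_not (s := S) p
  have h1 : (S.filter fun v => ¬ p v).card ≤ M * M ^ 2 := by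
    have hle : (S.filter fun v => ¬ p v).card ≤ (Finset.range M ×ˢ Finset.range (M ^ 2)).card := by
      refine Finset.card_le_card_of_injOn (fun v => (lab v).2) ?_ ?_
      · intro v _
        simpa using (hM v).2
      · intro v hv w hw hvw
        simp only [Finset.coe_filter, Set.mem_ofPred_eq] at hv hw
        refine hlab (Prod.ext ?_ hvw)
        rcases lt_trichotomy (lab v).1 (lab w).1 with h | h | h
        · exact absurd ⟨v, hv.1, hvw, h⟩ hw.2
        · exact h
        · exact absurd ⟨w, hw.1, hvw.symm, h⟩ hv.2
    simpa using hle
  have h2 : (S.filter p).card ≤ M * (2 * M ^ 2) := by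
    have hle : (S.filter p).card ≤ (Finset.range M ×ˢ Finset.range (2 * M ^ 2)).card := by
      refine Finset.card_le_card_of_injOn
        (fun v => ((lab v).1, (lab v).2.1 * (lab v).1 + (lab v).2.2)) ?_ ?_
      · intro v _
        obtain ⟨k1, k2, k3⟩ := hM v
        have : (lab v).2.1 * (lab v).1 ≤ M ^ 2 := by
          rw [pow_two]
          exact Nat.mul_le_mul k2.le k1.le
        simp only [Finset.coe_product, Finset.coe_range, Set.mem_prod, Set.mem_Iio]
        exact ⟨k1, by omega⟩
      · intro v hv w hw hvw
        simp only [Finset.coe_filter, Set.mem_ofPred_eq] at hv hw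
        obtain ⟨hx, hy⟩ := Prod.ext_iff.1 hvw
        simp only at hx hy
        rcases lt_trichotomy (lab v).2.1 (lab w).2.1 with h | h | h
        -- If `v` and `w` share a point and `w` is steeper, an incidence `z` further left on the
        -- line of `w` receives an arrow from `v`.
        · obtain ⟨z, hz, hzl, hzx⟩ := hw.2
          refine absurd ⟨?_, ?_, ?_⟩ (hno v hv.1 z hz)
          · rw [hzl, hy, hx]
          · rw [hx]; exact hzx
          · rw [hzl]; exact h
        · refine hlab (Prod.ext hx (Prod.ext h ?_))
          rw [h, hx] at hy
          omega
        · obtain ⟨z, hz, hzl, hzx⟩ := hv.2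
          refine absurd ⟨?_, ?_, ?_⟩ (hno w hw.1 z hz)
          · rw [hzl, ← hy, hx]
          · rw [← hx]; exact hzx
          · rw [hzl]; exact h
    simpa using hle
  have e1 : M * M ^ 2 = M ^ 3 := by ring
  have e2 : M * (2 * M ^ 2) = 2 * M ^ 3 := by ring
  omega

theorem exists_incidence_graph {M : ℕ} (hM : 1 ≤ M) :
    ∃ (V : Type) (_ : LinearOrder V) (_ : Fintype V) (_ : Nonempty V) (E : (Fin 2 → V) → Prop),
      Realizes incidencePred E ∧ Fintype.card V = M ^ 4 ∧ Hits (fun u => ¬ E u) 3 ∧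
        Hits E (3 * M ^ 3 + 1) := by
  have hcard : Fintype.card (Fin M × Fin M × Fin (M ^ 2)) = M ^ 4 := by
    simp only [Fintype.card_prod, Fintype.card_fin]
    ring
  let e : Fin (M ^ 4) ≃ Fin M × Fin M × Fin (M ^ 2) := (Fintype.equivFinOfCardEq hcard).symm
  let lab : Fin (M ^ 4) → ℕ × ℕ × ℕ := fun v => ((e v).1, (e v).2.1, (e v).2.2)
  have hlab : Function.Injective lab := by
    intro v w h
    simp only [lab, Prod.mk.injEq, Fin.val_inj] at h
    exact e.injective (Prod.ext h.1 (Prod.ext h.2.1 h.2.2))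
  refine ⟨Fin (M ^ 4), inferInstance, inferInstance, ⟨⟨0, Nat.pow_pos hM⟩⟩, incidenceRel lab,
    realizes_incidenceRel lab, Fintype.card_fin _, hits_not_incidenceRel lab,
    hits_incidenceRel hlab fun v => ⟨(e v).1.2, (e v).2.1.2, (e v).2.2.2⟩⟩

/-! ### Iteration and choice of parameters. -/

/-- The tower of `k` twos with `x` on the top. -/
def natTower : ℕ → ℕ → ℕ
  | 0, x => x
  | k + 1, x => 2 ^ natTower k x

theorem tower_le_natTower {x : ℝ} {y : ℕ} (h : x ≤ y) (k : ℕ) :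
    tower (k + 1) x ≤ (natTower k y : ℝ) := by
  induction k with
  | zero => exact h
  | succ k ih =>
    have h1 : tower (k + 2) x = (2 : ℝ) ^ tower (k + 1) x := rfl
    have h2 : (natTower (k + 1) y : ℝ) = (2 : ℝ) ^ (natTower k y : ℝ) := by
      rw [Real.rpow_natCast]
      simp [natTower]
    rw [h1, h2]
    exact Real.rpow_le_rpow_of_exponent_le one_le_two ih

/-- `A`, `s` and `C` are fixed before `M`, which makes the complexity and the clique size
independent of `n`. -/
theorem exists_hypergraphs (k : ℕ) :
    ∃ (κ : Type) (_ : Finite κ) (A : (Fin (k + 3) → Option κ → ℝ) → Prop) (s C : ℕ),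
      ScaleInvariant A ∧
      (IsSemialgPred fun x : Fin (k + 3) × Option κ → ℝ => A fun k l => x (k, l)) ∧
      ∀ M : ℕ, 1 ≤ M → ∃ (V : Type) (_ : LinearOrder V) (_ : Fintype V) (_ : Nonempty V)
        (E : (Fin (k + 3) → V) → Prop), Realizes A E ∧
          Fintype.card V = natTower (k + 1) (M ^ 4) ∧ Hits (fun u => ¬ E u) s ∧
            Hits E (2 ^ (C * M ^ 3)) := by
  classical
  have hword : ∀ (V : Type) [LinearOrder V] [Fintype V], ∃ (_ : Fintype (Colex (V → Bool))),
      Fintype.card (Colex (V → Bool)) = 2 ^ Fintype.card V := by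
    intro V _ _
    exact ⟨inferInstanceAs (Fintype (V → Bool)), (Fintype.card_fun (α := V) (β := Bool))⟩
  induction k with
  | zero =>
    -- The clique bound 3 is `t + 1` with `t = 2`; the 4 absorbs the additive 1 in the exponent and
    -- the one outside.
    refine ⟨Option (Fin 3), inferInstance, stepUpPred incidencePred, 2 ^ 2 + 1, 4,
      scaleInvariant_incidencePred.stepUpPred, isSemialgPred_incidencePred.stepUpPred, ?_⟩
    intro M hM
    obtain ⟨V, _, _, _, E, hE, hcard, hs, hn⟩ := exists_incidence_graph hM
    obtain ⟨_, hw⟩ := hword V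
    refine ⟨Colex (V → Bool), inferInstance, inferInstance,
      inferInstanceAs (Nonempty (V → Bool)), stepUp E, hE.stepUp scaleInvariant_incidencePred, ?_,
      hits_not_stepUp_two hs, (hits_stepUp_two hn).mono ?_⟩
    · rw [hw, hcard]
      rfl
    · have hM3 : 1 ≤ M ^ 3 := Nat.one_le_pow _ _ hM
      calc 2 ^ (3 * M ^ 3) + 1 ≤ 2 ^ (3 * M ^ 3) + 2 ^ (3 * M ^ 3) :=
            Nat.add_le_add_left Nat.one_le_two_pow _
        _ = 2 ^ (3 * M ^ 3 + 1) := by ring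
        _ ≤ 2 ^ (4 * M ^ 3) := Nat.pow_le_pow_right two_pos (by omega)
  | succ k ih =>
    obtain ⟨κ, _, A, s, C, hinv, hsemi, hex⟩ := ih
    refine ⟨Option κ, inferInstance, stepUpPred A, s + s + (k + 3) + 1, C + (k + 6),
      hinv.stepUpPred, hsemi.stepUpPred, ?_⟩
    intro M hM
    obtain ⟨V, _, _, _, E, hE, hcard, hs, hn⟩ := hex M hM
    obtain ⟨_, hw⟩ := hword V
    refine ⟨Colex (V → Bool), inferInstance, inferInstance,
      inferInstanceAs (Nonempty (V → Bool)), stepUp E, hE.stepUp hinv, ?_,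
      hits_not_stepUp (by omega) hs, (hits_stepUp (by omega) hn).mono ?_⟩
    · rw [hw, hcard]
      rfl
    · have hM3 : 1 ≤ M ^ 3 := Nat.one_le_pow _ _ hM
      set n := 2 ^ (C * M ^ 3)
      have hn1 : 1 ≤ n := Nat.one_le_two_pow
      calc n + n + (k + 3) + 1 ≤ n * (k + 6) := by nlinarith
        _ ≤ n * 2 ^ (k + 6) := Nat.mul_le_mul_left _ Nat.lt_two_pow_self.le
        _ = 2 ^ (C * M ^ 3 + (k + 6)) := (pow_add _ _ _).symm
        _ ≤ 2 ^ ((C + (k + 6)) * M ^ 3) := Nat.pow_le_pow_right two_pos (by nlinarith)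

/-- `M` is the floor of `c * L ^ (1/3)`. The hypothesis `hL` makes this real at least 2, so its
floor is at least half of it. -/
theorem exists_parameter {L c : ℝ} (hc : 0 < c) (hL : 8 ≤ c ^ 3 * L) :
    ∃ M : ℕ, 1 ≤ M ∧ (M : ℝ) ^ 3 ≤ c ^ 3 * L ∧ (c / 2) ^ 4 * L ^ (4 / 3 : ℝ) ≤ (M : ℝ) ^ 4 := by
  have hL0 : 0 < L := by
    by_contra h
    have := mul_nonpos_of_nonneg_of_nonpos (pow_pos hc 3).le (not_lt.1 h)
    linarith
  set x := L ^ (1 / 3 : ℝ) with hx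
  have hx0 : 0 < x := Real.rpow_pos_of_pos hL0 _
  have hx3 : x ^ 3 = L := by
    rw [hx, ← Real.rpow_natCast, ← Real.rpow_mul hL0.le]
    norm_num
  have hx4 : x ^ 4 = L ^ (4 / 3 : ℝ) := by
    rw [hx, ← Real.rpow_natCast, ← Real.rpow_mul hL0.le]
    norm_num
  have hcx : 2 ≤ c * x := by
    by_contra h
    have : (c * x) ^ 3 < 2 ^ 3 := pow_lt_pow_left₀ (not_le.1 h) (by positivity) (by norm_num)
    rw [mul_pow, hx3] at this
    linarith
  have h1 := Nat.floor_le (mul_pos hc hx0).le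
  have h2 := Nat.lt_floor_add_one (c * x)
  refine ⟨⌊c * x⌋₊, Nat.le_floor (by push_cast; linarith), ?_, ?_⟩
  · rw [← hx3, ← mul_pow]
    exact pow_le_pow_left₀ (Nat.cast_nonneg _) h1 3
  · rw [← hx4, ← mul_pow]
    exact pow_le_pow_left₀ (by positivity) (by linarith) 4

theorem mainTheorem2 (r : ℕ) (hr : 3 ≤ r) :
    ∃ s d D m : ℕ, ∃ o : ℕ → ℝ, Tendsto o atTop (𝓝 0) ∧
      ∀ᶠ n : ℕ in atTop,
        tower (r - 1) (Real.log n ^ (4 / 3 - o n)) < (semialgRamsey r d D m s n : ℝ) := by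
  obtain ⟨k, rfl⟩ : ∃ k, r = k + 3 := ⟨r - 3, by omega⟩
  obtain ⟨κ, _, A, s, C, -, hsemi, hex⟩ := exists_hypergraphs k
  obtain ⟨d, D, m, hR⟩ := exists_lt_semialgRamsey hsemi
  obtain ⟨c, hc0, hc⟩ : ∃ c : ℝ, 0 < c ∧ C * c ^ 3 ≤ 1 := by
    refine ⟨1 / (C + 1), by positivity, ?_⟩
    have h0 : (0 : ℝ) ≤ C := Nat.cast_nonneg _
    have h1 : (1 : ℝ) / (C + 1) ≤ 1 := by rw [div_le_one (by positivity)]; linarith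
    calc (C : ℝ) * (1 / (C + 1)) ^ 3 ≤ C * (1 / (C + 1)) :=
          mul_le_mul_of_nonneg_left (pow_le_of_le_one (by positivity) h1 (by norm_num)) h0
      _ ≤ 1 := by rw [mul_one_div, div_le_one (by positivity)]; linarith
  have hlog : Tendsto (fun n : ℕ => Real.log n) atTop atTop :=
    Real.tendsto_log_atTop.comp tendsto_natCast_atTop_atTop
  -- Chosen so that `L ^ (-o n)` equals the constant `(c / 2) ^ 4` lost in the choice of `M`, where
  -- `L = log n`.
  refine ⟨s, d, D, m, fun n => -Real.log ((c / 2) ^ 4) / Real.log (Real.log n),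
    (Real.tendsto_log_atTop.comp hlog).const_div_atTop _, ?_⟩
  filter_upwards [hlog.eventually_ge_atTop (8 / c ^ 3), hlog.eventually_gt_atTop 1,
    eventually_gt_atTop 0] with n hn8 hn1 hn0
  set L := Real.log n with hL
  have hL0 : 0 < L := by linarith
  have hn0' : (0 : ℝ) < n := Nat.cast_pos.2 hn0
  obtain ⟨M, hM1, hM3, hM4⟩ := exists_parameter (L := L) hc0 (by
    rw [div_le_iff₀ (pow_pos hc0 3)] at hn8
    linarith)
  obtain ⟨V, _, _, _, E, hE, hcard, hs, hn⟩ := hex M hM1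
  have hle : 2 ^ (C * M ^ 3) ≤ n := by
    have hCM : ((C * M ^ 3 : ℕ) : ℝ) ≤ L := by
      push_cast
      calc (C : ℝ) * (M : ℝ) ^ 3 ≤ C * (c ^ 3 * L) :=
            mul_le_mul_of_nonneg_left hM3 (Nat.cast_nonneg _)
        _ = C * c ^ 3 * L := by ring
        _ ≤ 1 * L := mul_le_mul_of_nonneg_right hc hL0.le
        _ = L := one_mul L
    have h2 : (2 : ℝ) ≤ Real.exp 1 := by
      have := Real.add_one_le_exp 1
      linarith
    have : ((2 ^ (C * M ^ 3) : ℕ) : ℝ) ≤ n := by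
      push_cast
      calc (2 : ℝ) ^ (C * M ^ 3) ≤ Real.exp 1 ^ (C * M ^ 3) := pow_le_pow_left₀ two_pos.le h2 _
        _ = Real.exp ((C * M ^ 3 : ℕ) : ℝ) := by rw [← Real.exp_nat_mul, mul_one]
        _ ≤ Real.exp L := Real.exp_le_exp.2 hCM
        _ = n := Real.exp_log hn0'
    exact_mod_cast this
  have hlt := hR s n hE hs (hn.mono hle)
  rw [hcard] at hlt
  have hexp : L ^ (4 / 3 - -Real.log ((c / 2) ^ 4) / Real.log L) ≤ ((M ^ 4 : ℕ) : ℝ) := by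
    have hc4 : 0 < (c / 2) ^ 4 := by positivity
    have hlL : Real.log L ≠ 0 := (Real.log_pos hn1).ne'
    have hpow : L ^ (Real.log ((c / 2) ^ 4) / Real.log L) = (c / 2) ^ 4 := by
      rw [Real.rpow_def_of_pos hL0, mul_div_cancel₀ _ hlL, Real.exp_log hc4]
    rw [neg_div, sub_neg_eq_add, Real.rpow_add hL0, hpow, mul_comm]
    push_cast
    exact hM4
  exact (tower_le_natTower hexp (k + 1)).trans_lt (by exact_mod_cast hlt)
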